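/- **Definitions.** A *premetric space* is a set $P$ with a function $d_P:P\times P\to[0,\infty)$ such that $d_P(x,x)=0$ for all $x$. *Complete oriented graph.* For a set $P$ let $\Gamma P=P\cup\{(x,y,t):x,y\in P,\ x\ne y,\ 0<t<1\}$. For $x,y\in P$, $t\in[0,1]$ let $\langle x,y,t\rangle=(x,y,t)$ if $x\neq y$ and $0<t<1$, let $\langle x,y,0\rangle=x$, $\langle x,y,1\rangle=y$, and $\langle x,x,t\rangle=x$. The metric of $\Gamma P$ is the path metric: $d(a,b)$ is the least value of $\sum_{i=1}^n|t_i-s_i|$ over all chains $a=a_0,a_1,\dots,a_n=b$, $n\ge0$, such that $a_{i-1}=\langle x_i,y_i,t_i\rangle$ and $a_i=\langle x_i,y_i,s_i\rangle$ for some $x_i\ne y_i$ in $P$ and $t_i,s_i\in[0,1]$. *Cobweb.* The cobweb of a premetric space $P$ is $\circledast P=\{\langle x,y,t\rangle\in\Gamma P: t\le 1-\min\{1,d_P(y,x)\}\}$ with the metric induced from $\Gamma P$. The compression map $\pi_P:\circledast P\to P$ is $\pi_P(x)=x$ for $x\in P$ and $\pi_P(x,y,t)=x$ otherwise. Put $\circledast^1P=\circledast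 P$, $\circledast^{n+1}P=\circledast(\circledast^nP)$, and $$\circledast^\omega P=\Big\{(a_n)_{n\ge1}\in\prod_{n\ge1}\circledast^nP:\ \pi_{\circledast^nP}(a_{n+1})=a_n\text{ for all }n\Big\},\qquad d(a,b)=\max_{n\ge1}\tfrac1n\,d_{\circledast^nP}(a_n,b_n).$$ *Resolution.* Let $S_0=\{0\}\cup\{\frac1n:n\ge1\}\subset\mathbb R$. For a topological space $X$ let $\mathsf DX=C(S_0,X)\times S_0$ with the premetric $d((f,t),(g,s))=0$ if $f(t)=g(s)$, $=|t-s|$ if $f(t)\ne g(s)$ and $f=g$, and $=1$ otherwise. Let $\mathsf EX=\circledast^\omega(\mathsf DX)$. Let $\mathsf sX$ be the set $X$ with the topology of all sequentially open sets, where $V\subset X$ is sequentially open if every sequence converging to a point of $V$ is eventually in $V$. The resolution map $\xi_X:\mathsf EX\to\mathsf sX$ sends $(a_n)_{n\ge 1}$ to $f(t)$, where $(f,t)=\pi_{\mathsf DX}(a_1)\in \mathsf DX$; it is also regarded as a map $\mathsf EX\to X$. *Terminology.* The density of a subset $A$ of a topological space is $\mathrm{dens}(A)=\min\{|D|:D\subset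 A\subset\overline D\}$. A metric space $(Y,d)$ is *economical* if $|d(A\times A)|\le\mathrm{dens}(A)$ for every infinite $A\subset Y$. A surjection $f$ between topological spaces is *monotone* if all its fibres are connected; *quotient* if a subset of the target is open exactly when its preimage is open; *hereditarily quotient* if for every subset $A$ of the target the restriction $f^{-1}(A)\to A$ is quotient. A space $X$ is *sequential* if every non-closed $A\subset X$ contains a sequence converging to a point of $X\setminus A$; it is *Fréchet–Urysohn* if every point of the closure of any $A\subset X$ is the limit of a sequence in $A$. A space is *nonseparably connected* if it is connected and each of its nonempty connected separable subspaces is a singleton. Connected spaces are taken to be nonempty. **Theorem.** For every topological space $X$: 1. $\mathsf EX$ is an economical complete metric space, and $|\mathsf EX|\le\mathfrak c\cdot|X|^\omega$; 2. $\xi_X:\mathsf EX\to\mathsf sX$ is a monotone quotient surjection; 3. $\mathsf EX$ is connected if and only if $\mathsf sX$ is connected; 4. $\xi_X:\mathsf EX\to X$ is quotient if and only if $X$ is sequential; 5. $\xi_X:\mathsf EX\to X$ is hereditarily quotient if and only if $X$ is Fréchet–Urysohn; 6. each point of $\mathsf EX$ has a neighbourhood $U$ such that $\xi_X(U)\subset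 f(S_0)$ for some continuous $f:S_0\to X$; 7. if $X$ is connected and sequential, then $\mathsf EX$ is nonseparably connected and $\xi_X:\mathsf EX\to X$ is a monotone quotient surjection; so $X$ is a monotone quotient image of a nonseparably connected complete metric space. -/

import Mathlib

universe u

namespace EconRes

open Set Filter Topology

/-! ### Classes of metric spaces and of maps -/

/-- The density `dens A = min {|D| : D ⊆ A ⊆ closure D}` of a subset of a topological space. -/
noncomputable def dens {Y : Type u} [TopologicalSpace Y] (A : Set Y) : Cardinal.{u} :=
  sInf {κ | ∃ D : Set Y, D ⊆ A ∧ A ⊆ closure D ∧ Cardinal.mk D = κ}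

/-- A metric space is economical if `|d(A × A)| ≤ dens A` for every infinite subset `A`. -/
def IsEconomical (Y : Type u) [MetricSpace Y] : Prop :=
  ∀ A : Set Y, A.Infinite →
    Cardinal.lift.{u} (Cardinal.mk (image2 (fun a b : Y => dist a b) A A)) ≤
      Cardinal.lift.{0} (dens A)

/-- Nonseparably connected: connected, and every connected separable subspace is a singleton. -/
def IsNonseparablyConnected (Y : Type u) [TopologicalSpace Y] : Prop :=
  ConnectedSpace Y ∧
    ∀ A : Set Y, IsConnected A → TopologicalSpace.SeparableSpace A → ∃ y, A = {y}

/-- A surjective map all of whose fibres are connected. -/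
def IsMonotoneSurjection {Y Z : Type u} [TopologicalSpace Y] (f : Y → Z) : Prop :=
  Function.Surjective f ∧ ∀ z, IsConnected (f ⁻¹' {z})

/-- All restrictions `f | f⁻¹(A) : f⁻¹(A) → A` are quotient maps. -/
def IsHereditarilyQuotient {Y Z : Type u} [TopologicalSpace Y] [TopologicalSpace Z]
    (f : Y → Z) : Prop :=
  ∀ A : Set Z, IsQuotientMap (A.restrictPreimage f)

/-! ### The sequential coreflexion -/

/-- `V` is sequentially open. -/
def SeqOpen {X : Type u} [TopologicalSpace X] (V : Set X) : Prop :=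
  ∀ (x : ℕ → X) (p : X), Tendsto x atTop (𝓝 p) → p ∈ V → ∃ n, ∀ m ≥ n, x m ∈ V

/-- The set `X`, to be endowed with the topology of all sequentially open sets. -/
def SeqCoreflexion (X : Type u) : Type u := X

instance (X : Type u) [TopologicalSpace X] : TopologicalSpace (SeqCoreflexion X) where
  IsOpen V := SeqOpen (X := X) V
  isOpen_univ := fun _ _ _ _ => ⟨0, fun _ _ => trivial⟩
  isOpen_inter := by
    intro s t hs ht x p hx hp
    obtain ⟨n, hn⟩ := hs x p hx hp.1
    obtain ⟨k, hk⟩ := ht x p hx hp.2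
    exact ⟨max n k, fun m hm => ⟨hn m (le_trans (le_max_left _ _) hm),
      hk m (le_trans (le_max_right _ _) hm)⟩⟩
  isOpen_sUnion := by
    intro S hS x p hx hp
    obtain ⟨s, hs, hps⟩ := hp
    obtain ⟨n, hn⟩ := hS s hs x p hx hps
    exact ⟨n, fun m hm => ⟨s, hs, hn m hm⟩⟩

/-- The identity map `X → sX` (of sets). -/
def toSeq {X : Type u} (x : X) : SeqCoreflexion X := x

/-- The identity map `sX → X`. -/
def ofSeq {X : Type u} (x : SeqCoreflexion X) : X := x

/-! ### Premetric spaces and the sequential decomposition -/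

/-- A premetric space: a set with `d : X × X → [0, ∞)` such that `d x x = 0`. -/
structure PremetricSpace : Type (u + 1) where
  carrier : Type u
  d : carrier → carrier → ℝ
  d_nonneg : ∀ x y, 0 ≤ d x y
  d_self : ∀ x, d x x = 0

/-- A metric space, regarded as a premetric space. -/
def PremetricSpace.ofMetric (Y : Type u) [MetricSpace Y] : PremetricSpace.{u} where
  carrier := Y
  d := fun a b => dist a b
  d_nonneg := fun _ _ => dist_nonneg
  d_self := dist_self

/-- The standard convergent sequence `{0} ∪ {1/n : n ≥ 1}`. -/
def S₀ : Set ℝ := {0} ∪ {t | ∃ n : ℕ, 1 ≤ n ∧ t = 1 / (n : ℝ)}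

open Classical in
/-- The sequential decomposition `DX = C(S₀, X) × S₀` with its premetric. -/
noncomputable def seqDecomposition (X : Type u) [TopologicalSpace X] : PremetricSpace.{u} where
  carrier := C(S₀, X) × S₀
  d := fun a b =>
    if a.1 a.2 = b.1 b.2 then 0
    else if a.1 = b.1 then |(a.2 : ℝ) - (b.2 : ℝ)|
    else 1
  d_nonneg := by
    intro a b
    split_ifs
    · exact le_rfl
    · exact abs_nonneg _
    · exact zero_le_one
  d_self := by
    intro a
    simp

/-- The calculation map `c_X : DX → sX`, `(f, t) ↦ f t`. -/
def calculation (X : Type u) [TopologicalSpace X] (a : (seqDecomposition X).carrier) :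
    SeqCoreflexion X :=
  let b : C(S₀, X) × S₀ := a
  toSeq (b.1 b.2)

/-! ### The complete oriented graph with its path metric -/

/-- The underlying set of the complete oriented graph: the vertices `x`, and the points
`(x, y, t)` with `x ≠ y` and `0 < t < 1`. -/
inductive OGraph (X : Type u) : Type u
  | vertex (x : X) : OGraph X
  | edge (x y : X) (h : x ≠ y) (t : ℝ) (ht : t ∈ Ioo (0 : ℝ) 1) : OGraph X

open Classical in
/-- The point `⟨x, y, t⟩` for `t ∈ [0, 1]`. -/
noncomputable def OGraph.pt {X : Type u} (x y : X) (t : Icc (0 : ℝ) 1) : OGraph X :=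
  if h : x ≠ y ∧ (t : ℝ) ∈ Ioo (0 : ℝ) 1 then OGraph.edge x y h.1 t h.2
  else if (t : ℝ) = 0 then OGraph.vertex x
  else OGraph.vertex y

/-- `a` and `b` lie on a common edge `[x, y]`, `x ≠ y`, at distance `r` along this edge. -/
def OGraph.EdgeDist {X : Type u} (a b : OGraph X) (r : ℝ) : Prop :=
  ∃ x y : X, x ≠ y ∧ ∃ t s : Icc (0 : ℝ) 1,
    a = OGraph.pt x y t ∧ b = OGraph.pt x y s ∧ r = |(t : ℝ) - (s : ℝ)|

/-- `Chain a b ℓ`: there are points `a = a₀, a₁, …, aₙ = b`, consecutive ones on a common edge,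
for which the sum of the distances along these edges is `ℓ`. -/
inductive OGraph.Chain {X : Type u} (a : OGraph X) : OGraph X → ℝ → Prop
  | refl : OGraph.Chain a a 0
  | step {b c : OGraph X} {l r : ℝ} :
      OGraph.Chain a b l → OGraph.EdgeDist b c r → OGraph.Chain a c (l + r)

/-- The path distance: the least length of a chain from `a` to `b`. -/
noncomputable def OGraph.pathDist {X : Type u} (a b : OGraph X) : ℝ :=
  sInf {l | OGraph.Chain a b l}

namespace OGraph

variable {X : Type u}

lemma pt_vertex_left (x y : X) : pt x y ⟨0, by simp⟩ = vertex x := by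
  simp [pt]

lemma pt_vertex_right (x y : X) : pt x y ⟨1, by simp⟩ = vertex y := by
  simp [pt]

lemma pt_edge (x y : X) (h : x ≠ y) (t : ℝ) (ht : t ∈ Ioo (0 : ℝ) 1) :
    pt x y ⟨t, ht.1.le, ht.2.le⟩ = edge x y h t ht := by
  simp only [mem_Ioo] at ht
  simp [pt, h, ht.1, ht.2]

lemma pt_cases (x y : X) (h : x ≠ y) (t : Icc (0 : ℝ) 1) :
    ((t : ℝ) = 0 ∧ pt x y t = vertex x) ∨ ((t : ℝ) = 1 ∧ pt x y t = vertex y) ∨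
      ∃ ht : (t : ℝ) ∈ Ioo (0 : ℝ) 1, pt x y t = edge x y h t ht := by
  obtain ⟨t, h0, h1⟩ := t
  rcases h0.eq_or_lt with h0 | h0
  · left; subst h0; exact ⟨rfl, pt_vertex_left x y⟩
  rcases h1.eq_or_lt with h1 | h1
  · right; left; subst h1; exact ⟨rfl, pt_vertex_right x y⟩
  · right; right; exact ⟨⟨h0, h1⟩, pt_edge x y h t ⟨h0, h1⟩⟩

lemma EdgeDist.symm {a b : OGraph X} {r : ℝ} (h : EdgeDist a b r) : EdgeDist b a r := by
  obtain ⟨x, y, hxy, t, s, ha, hb, hr⟩ := h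
  exact ⟨x, y, hxy, s, t, hb, ha, by rw [hr, abs_sub_comm]⟩

lemma EdgeDist.nonneg {a b : OGraph X} {r : ℝ} (h : EdgeDist a b r) : 0 ≤ r := by
  obtain ⟨x, y, hxy, t, s, ha, hb, hr⟩ := h
  rw [hr]; exact abs_nonneg _

lemma Chain.nonneg {a b : OGraph X} {l : ℝ} (h : Chain a b l) : 0 ≤ l := by
  induction h with
  | refl => exact le_rfl
  | step _ h2 ih => exact add_nonneg ih h2.nonneg

lemma Chain.trans {a b c : OGraph X} {l m : ℝ} (h : Chain a b l) (h' : Chain b c m) :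
    Chain a c (l + m) := by
  induction h' with
  | refl => simpa using h
  | step _ h2 ih => rw [← add_assoc]; exact ih.step h2

lemma EdgeDist.chain {a b : OGraph X} {r : ℝ} (h : EdgeDist a b r) : Chain a b r := by
  simpa using (Chain.refl (a := a)).step h

lemma Chain.symm {a b : OGraph X} {l : ℝ} (h : Chain a b l) : Chain b a l := by
  induction h with
  | refl => exact Chain.refl
  | step _ h2 ih => rw [add_comm]; exact h2.symm.chain.trans ih

lemma Chain.lipschitz {f : OGraph X → ℝ}
    (hf : ∀ a b r, EdgeDist a b r → |f a - f b| ≤ r) {a b : OGraph X} {l : ℝ}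
    (h : Chain a b l) : |f a - f b| ≤ l := by
  induction h with
  | refl => simp
  | @step b c l r _ h2 ih =>
    calc |f a - f c| ≤ |f a - f b| + |f b - f c| := abs_sub_le _ _ _
      _ ≤ l + r := add_le_add ih (hf _ _ _ h2)

lemma chain_vertex (a : OGraph X) : ∃ v l, l ≤ 1 ∧ Chain a (vertex v) l := by
  cases a with
  | vertex x => exact ⟨x, 0, zero_le_one, Chain.refl⟩
  | edge x y h t ht =>
    refine ⟨x, |t - 0|, ?_, EdgeDist.chain ⟨x, y, h, ⟨t, ht.1.le, ht.2.le⟩, ⟨0, by simp⟩,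
      (pt_edge x y h t ht).symm, (pt_vertex_left x y).symm, rfl⟩⟩
    rw [sub_zero, abs_of_pos ht.1]; exact ht.2.le

lemma chain_vertices (x y : X) : ∃ l ≤ 1, Chain (vertex x) (vertex y) l := by
  by_cases h : x = y
  · subst h; exact ⟨0, zero_le_one, Chain.refl⟩
  · refine ⟨|0 - 1|, by simp, EdgeDist.chain ⟨x, y, h, ⟨0, by simp⟩, ⟨1, by simp⟩,
      (pt_vertex_left x y).symm, (pt_vertex_right x y).symm, rfl⟩⟩

lemma exists_chain (a b : OGraph X) : ∃ l ≤ 3, Chain a b l := by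
  obtain ⟨v, l, hl, h⟩ := chain_vertex a
  obtain ⟨w, m, hm, h'⟩ := chain_vertex b
  obtain ⟨k, hk, h''⟩ := chain_vertices v w
  exact ⟨(l + k) + m, by linarith, (h.trans h'').trans h'.symm⟩

lemma bddBelow (a b : OGraph X) : BddBelow {l | Chain a b l} :=
  ⟨0, fun _ h => Chain.nonneg h⟩

lemma pathDist_le {a b : OGraph X} {l : ℝ} (h : Chain a b l) : pathDist a b ≤ l :=
  csInf_le (bddBelow a b) h

lemma le_pathDist {a b : OGraph X} {r : ℝ} (h : ∀ l, Chain a b l → r ≤ l) : r ≤ pathDist a b := by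
  obtain ⟨l, _, hl⟩ := exists_chain a b
  exact le_csInf ⟨l, hl⟩ h

lemma pathDist_le_three (a b : OGraph X) : pathDist a b ≤ 3 := by
  obtain ⟨l, h, hl⟩ := exists_chain a b
  exact (pathDist_le hl).trans h

open Classical in
/-- Every point is separated from any other by a function that is `1`-Lipschitz on every edge. -/
lemma exists_peak (a : OGraph X) : ∃ f : OGraph X → ℝ,
    (∀ b c r, EdgeDist b c r → |f b - f c| ≤ r) ∧ ∀ b, f b = f a → b = a := by
  cases a with
  | vertex v =>
    let f : OGraph X → ℝ := fun p => match p with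
      | vertex x => if x = v then 1 else 0
      | edge x y _ t _ => if x = v then 1 - t else if y = v then t else 0
    have key : ∀ x y : X, x ≠ y → ∀ t : Icc (0 : ℝ) 1,
        f (pt x y t) = if x = v then 1 - (t : ℝ) else if y = v then (t : ℝ) else 0 := by
      intro x y h t
      rcases pt_cases x y h t with ⟨h0, h1⟩ | ⟨h0, h1⟩ | ⟨h0, h1⟩
      · rw [h1, h0]; simp [f]
      · rw [h1, h0]
        by_cases hx : x = v
        · have : ¬ y = v := fun hy => h (hx.trans hy.symm)
          simp [f, hx, this]
        · simp [f, hx]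
      · rw [h1]
    refine ⟨f, ?_, ?_⟩
    · rintro b c r ⟨x, y, h, t, s, rfl, rfl, rfl⟩
      rw [key x y h, key x y h]
      split_ifs
      · rw [abs_sub_comm]; apply le_of_eq; congr 1; ring
      · exact le_rfl
      · simp
    · intro b hb
      have h1 : f (vertex v) = 1 := by simp [f]
      rw [h1] at hb
      cases b with
      | vertex x =>
        by_cases hx : x = v
        · rw [hx]
        · simp [f, hx] at hb
      | edge x y h t ht =>
        exfalso
        have h0 := ht.1
        have h2 := ht.2
        simp only [f] at hb
        split_ifs at hb <;> linarith
  | edge u w huw t₀ ht₀ =>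
    let g : ℝ → ℝ := fun t => max 0 (min t₀ (1 - t₀) - |t - t₀|)
    have hε : 0 < min t₀ (1 - t₀) := lt_min ht₀.1 (by linarith [ht₀.2])
    have hg : ∀ t s, |g t - g s| ≤ |t - s| := by
      intro t s
      have h1 : |g t - g s| ≤ |(min t₀ (1 - t₀) - |t - t₀|) - (min t₀ (1 - t₀) - |s - t₀|)| := by
        simp only [g]
        have := abs_max_sub_max_le_abs (min t₀ (1 - t₀) - |t - t₀|)
          (min t₀ (1 - t₀) - |s - t₀|) 0
        rwa [max_comm 0, max_comm 0]
      refine h1.trans ?_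
      have h2 : (min t₀ (1 - t₀) - |t - t₀|) - (min t₀ (1 - t₀) - |s - t₀|)
          = |s - t₀| - |t - t₀| := by ring
      rw [h2]
      refine (abs_abs_sub_abs_le_abs_sub _ _).trans ?_
      rw [abs_sub_comm t s]
      apply le_of_eq; congr 1; ring
    have g0 : g 0 = 0 := by
      simp only [g]
      apply max_eq_left
      have : |(0 : ℝ) - t₀| = t₀ := by rw [zero_sub, abs_neg, abs_of_pos ht₀.1]
      rw [this]; linarith [min_le_left t₀ (1 - t₀)]
    have g1 : g 1 = 0 := by
      simp only [g]
      apply max_eq_left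
      have : |(1 : ℝ) - t₀| = 1 - t₀ := abs_of_pos (by linarith [ht₀.2])
      rw [this]; linarith [min_le_right t₀ (1 - t₀)]
    have gt : ∀ t, g t = min t₀ (1 - t₀) → t = t₀ := by
      intro t ht
      by_contra hne
      have hpos : 0 < |t - t₀| := abs_pos.mpr (sub_ne_zero.mpr hne)
      have : g t < min t₀ (1 - t₀) := max_lt hε (by linarith)
      linarith
    let f : OGraph X → ℝ := fun p => match p with
      | vertex _ => 0
      | edge x y _ t _ => if x = u ∧ y = w then g t else 0
    have key : ∀ x y : X, x ≠ y → ∀ t : Icc (0 : ℝ) 1,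
        f (pt x y t) = if x = u ∧ y = w then g t else 0 := by
      intro x y h t
      rcases pt_cases x y h t with ⟨h0, h1⟩ | ⟨h0, h1⟩ | ⟨h0, h1⟩
      · rw [h1, h0, g0]; simp [f]
      · rw [h1, h0, g1]; simp [f]
      · rw [h1]
    refine ⟨f, ?_, ?_⟩
    · rintro b c r ⟨x, y, h, t, s, rfl, rfl, rfl⟩
      rw [key x y h, key x y h]
      split_ifs
      · exact hg _ _
      · simp
    · intro b hb
      have h1 : f (edge u w huw t₀ ht₀) = min t₀ (1 - t₀) := by
        simp only [f, g, and_self, if_true, sub_self, abs_zero, sub_zero]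
        exact max_eq_right hε.le
      rw [h1] at hb
      cases b with
      | vertex x => exact absurd hb hε.ne
      | edge x y h t ht =>
        simp only [f] at hb
        split_ifs at hb with hxy
        · obtain ⟨rfl, rfl⟩ := hxy
          have := gt t hb
          subst this
          rfl
        · exact absurd hb hε.ne

/-- The complete oriented graph with the path metric. -/
noncomputable instance : MetricSpace (OGraph X) where
  dist := pathDist
  dist_self a := le_antisymm (pathDist_le Chain.refl) (le_pathDist fun _ h => h.nonneg)
  dist_comm a b := by
    unfold pathDist
    congr 1
    ext l
    exact ⟨Chain.symm, Chain.symm⟩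
  dist_triangle a b c := by
    have h1 : ∀ l, Chain a b l → pathDist a c - l ≤ pathDist b c := fun l hl =>
      le_pathDist fun m hm => by linarith [pathDist_le (hl.trans hm)]
    have h2 : pathDist a c - pathDist b c ≤ pathDist a b :=
      le_pathDist fun l hl => by linarith [h1 l hl]
    linarith
  eq_of_dist_eq_zero := by
    intro a b hab
    obtain ⟨f, hf, hf'⟩ := exists_peak b
    have h : |f a - f b| ≤ pathDist a b := le_pathDist fun l hl => hl.lipschitz hf
    have h0 : pathDist a b = 0 := hab
    rw [h0] at h
    exact hf' a (sub_eq_zero.mp (abs_nonpos_iff.mp h))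

lemma dist_le_three (a b : OGraph X) : dist a b ≤ 3 := pathDist_le_three a b

end OGraph

/-! ### The cobweb, its iterations and their limit -/

/-- The cobweb `{⟨x, y, t⟩ : t ≤ 1 - min {1, d (y, x)}}` of a premetric space, as a subset of the
complete oriented graph. -/
def cobwebSet (P : PremetricSpace.{u}) : Set (OGraph P.carrier) :=
  {a | ∃ (x y : P.carrier) (t : Icc (0 : ℝ) 1),
    a = OGraph.pt x y t ∧ (t : ℝ) ≤ 1 - min 1 (P.d y x)}

/-- The cobweb with the metric induced from the complete oriented graph. -/
def Cobweb (P : PremetricSpace.{u}) : Type u := cobwebSet P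

noncomputable instance (P : PremetricSpace.{u}) : MetricSpace (Cobweb P) :=
  inferInstanceAs (MetricSpace (cobwebSet P))

/-- The compression map of the cobweb: vertices are fixed, and `(x, y, t) ↦ x`. -/
def compression (P : PremetricSpace.{u}) (a : Cobweb P) : P.carrier :=
  match a.1 with
  | OGraph.vertex x => x
  | OGraph.edge x _ _ _ _ => x

/-- `iter P 0 = P`, and `iter P n` is the `n`-th iterated cobweb of `P` for `n ≥ 1`. -/
noncomputable def iter (P : PremetricSpace.{u}) : ℕ → PremetricSpace.{u}
  | 0 => P
  | n + 1 => PremetricSpace.ofMetric (Cobweb (iter P n))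

/-- The limit of the inverse sequence of the iterated cobwebs and their compression maps. The
coordinate with index `n` lies in the `(n + 1)`-st iterated cobweb `Cobweb (iter P n)`, which is
the carrier of `iter P (n + 1)`. -/
def CobwebLimit (P : PremetricSpace.{u}) : Type u :=
  {a : ∀ n : ℕ, Cobweb (iter P n) // ∀ n, compression (iter P (n + 1)) (a (n + 1)) = a n}

lemma bddAbove_limit {P : PremetricSpace.{u}} (a b : CobwebLimit P) :
    BddAbove (range fun n : ℕ => 1 / ((n : ℝ) + 1) * dist (a.1 n) (b.1 n)) := by
  refine ⟨3, ?_⟩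
  rintro _ ⟨n, rfl⟩
  have h1 : dist (a.1 n) (b.1 n) ≤ 3 := OGraph.dist_le_three (a.1 n).1 (b.1 n).1
  have h2 : 1 / ((n : ℝ) + 1) ≤ 1 := by
    rw [div_le_one (by positivity)]
    linarith [Nat.cast_nonneg (α := ℝ) n]
  calc 1 / ((n : ℝ) + 1) * dist (a.1 n) (b.1 n) ≤ 1 * dist (a.1 n) (b.1 n) :=
        mul_le_mul_of_nonneg_right h2 dist_nonneg
    _ ≤ 3 := by linarith

/-- The metric `max_{n ≥ 1} (1/n) d(aₙ, bₙ)` of the limit. -/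
noncomputable instance (P : PremetricSpace.{u}) : MetricSpace (CobwebLimit P) where
  dist a b := ⨆ n : ℕ, 1 / ((n : ℝ) + 1) * dist (a.1 n) (b.1 n)
  dist_self a := by simp
  dist_comm a b := by simp only [dist_comm]
  dist_triangle a b c := by
    refine ciSup_le fun n => ?_
    have h1 := le_ciSup (bddAbove_limit a b) n
    have h2 := le_ciSup (bddAbove_limit b c) n
    have h3 : 1 / ((n : ℝ) + 1) * dist (a.1 n) (c.1 n) ≤
        1 / ((n : ℝ) + 1) * (dist (a.1 n) (b.1 n) + dist (b.1 n) (c.1 n)) :=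
      mul_le_mul_of_nonneg_left (dist_triangle _ _ _) (by positivity)
    rw [mul_add] at h3
    exact h3.trans (add_le_add h1 h2)
  eq_of_dist_eq_zero := by
    intro a b h
    apply Subtype.ext
    funext n
    have h1 := le_ciSup (bddAbove_limit a b) n
    have h2 : 1 / ((n : ℝ) + 1) * dist (a.1 n) (b.1 n) ≤ 0 := h1.trans (le_of_eq h)
    have h3 : (0 : ℝ) < 1 / ((n : ℝ) + 1) := by positivity
    exact dist_le_zero.mp (nonpos_of_mul_nonpos_right h2 h3)

/-- The map of the limit of the iterated cobwebs of `P` onto `P`: the projection to the first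
cobweb, followed by the compression map of the first cobweb. -/
def limitCompression (P : PremetricSpace.{u}) (a : CobwebLimit P) : P.carrier :=
  compression P (a.1 0)

/-! ### The economical resolution -/

/-- The economical resolution `EX` of a topological space. -/
def EconomicalResolution (X : Type u) [TopologicalSpace X] : Type u :=
  CobwebLimit (seqDecomposition X)

noncomputable instance (X : Type u) [TopologicalSpace X] : MetricSpace (EconomicalResolution X) :=
  inferInstanceAs (MetricSpace (CobwebLimit (seqDecomposition X)))

/-- The resolution map `ξ : EX → sX`. -/
noncomputable def resolutionSeq (X : Type u) [TopologicalSpace X] (a : EconomicalResolution X) :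
    SeqCoreflexion X :=
  calculation X (limitCompression (seqDecomposition X) a)

/-- The resolution map `ξ`, regarded as a map `EX → X`. -/
noncomputable def resolution (X : Type u) [TopologicalSpace X] (a : EconomicalResolution X) : X :=
  ofSeq (resolutionSeq X a)

end EconRes

open EconRes Topology

/-!
The whole argument rests on the local structure of a cobweb. A point inside an edge has a
neighbourhood inside this edge, and an edge `(y, v)` runs close to the vertex `v` only if `d (v, y)`
is small (`compression_of_dist_vertex_lt_one`, `exists_compression_eq_dist_lt`). So a set `V` in `P`
has an open preimage under the compression map exactly when each `v ∈ V` has all `y` with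
`d (v, y)` small in `V`. Applied to `DX`, where `(f, t)` is close to `(f, s)` for `s` close to `t`,
this says that the open sets pulled back by the resolution map are the sequentially open ones
(`isOpen_resolution_preimage_iff`): convergent sequences of `X` lift to `EX`
(`exists_tendsto_resolution_eq`), and near any point of `EX` the resolution map takes only values of
one `f` (`exists_eventually_resolution_eq`). The statements on quotient and hereditarily quotient
maps follow from the lifting of sequences.

Over a metric space the compression map does not increase distances below one
(`dist_compression_le`). This is read off from a 1-Lipschitz function on the complete oriented graph
(`truncDist`), with no analysis of shortest chains. So the inverse limit is complete and its
coordinates control its metric.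

The fibres of the resolution map are connected because the preimage in the limit of a connected
subset of an iterated cobweb is connected (`isPreconnected_coord_preimage`). Fibres of the single
compression maps are stars, hence connected, and each projection of the limit is open at those
threads that continue by vertices. A separation of the preimage of a connected set therefore
separates the fibre over one of its points, then the fibre over a point of the star of that point,
and so on. The thread so obtained would have points of both parts in each of its neighbourhoods.

Finally, the closure of a set `D` in a cobweb compresses into the set of the ends of the edges
through `D`, which has cardinality at most that of `D` when `D` is infinite. As each coordinate in
the limit is the compression of the next one, a set of density `κ` has at most `κ` points in each
coordinate, and so at most `κ` distances (`CobwebLimit.isEconomical`). A connected set with two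
points realizes uncountably many distances, so it is not separable.
-/

namespace EconRes

open Set Filter Topology

/-! ### Geometry of the complete oriented graph -/

namespace OGraph

variable {X : Type u}

lemma abs_sub_le_dist {f : OGraph X → ℝ} (hf : ∀ a b r, EdgeDist a b r → |f a - f b| ≤ r)
    (a b : OGraph X) : |f a - f b| ≤ dist a b :=
  le_pathDist fun _ hl => hl.lipschitz hf

lemma dist_pt_le {x y : X} (h : x ≠ y) (t s : Icc (0 : ℝ) 1) :
    dist (pt x y t) (pt x y s) ≤ |(t : ℝ) - s| :=
  pathDist_le (EdgeDist.chain ⟨x, y, h, t, s, rfl, rfl, rfl⟩)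

lemma dist_edge_vertex_left_le {x y : X} (h : x ≠ y) (t : ℝ) (ht : t ∈ Ioo (0 : ℝ) 1) :
    dist (edge x y h t ht) (vertex x) ≤ t := by
  have := dist_pt_le h ⟨t, ht.1.le, ht.2.le⟩ ⟨0, by simp⟩
  rwa [pt_edge x y h t ht, pt_vertex_left, sub_zero, abs_of_pos ht.1] at this

lemma dist_edge_vertex_right_le {x y : X} (h : x ≠ y) (t : ℝ) (ht : t ∈ Ioo (0 : ℝ) 1) :
    dist (edge x y h t ht) (vertex y) ≤ 1 - t := by
  have := dist_pt_le h ⟨t, ht.1.le, ht.2.le⟩ ⟨1, by simp⟩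
  rwa [pt_edge x y h t ht, pt_vertex_right, abs_sub_comm, abs_of_pos (sub_pos.2 ht.2)] at this

open Classical in
/-- The function that decreases linearly from `1` at the vertex `v` to `0` at the other end of each
edge containing `v`, and vanishes on all other edges. -/
noncomputable def hat (v : X) : OGraph X → ℝ
  | vertex x => if x = v then 1 else 0
  | edge x y _ t _ => if x = v then 1 - t else if y = v then t else 0

open Classical in
lemma hat_pt (v : X) {x y : X} (h : x ≠ y) (t : Icc (0 : ℝ) 1) :
    hat v (pt x y t) = if x = v then 1 - (t : ℝ) else if y = v then (t : ℝ) else 0 := by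
  rcases pt_cases x y h t with ⟨h0, h1⟩ | ⟨h0, h1⟩ | ⟨h0, h1⟩
  · rw [h1, h0]; simp [hat]
  · rw [h1, h0]
    by_cases hx : x = v
    · have : ¬ y = v := fun hy => h (hx.trans hy.symm)
      simp [hat, hx, this]
    · simp [hat, hx]
  · rw [h1]; rfl

lemma abs_hat_sub_le (v : X) (a b : OGraph X) : |hat v a - hat v b| ≤ dist a b := by
  classical
  refine abs_sub_le_dist ?_ a b
  rintro b c r ⟨x, y, h, t, s, rfl, rfl, rfl⟩
  rw [hat_pt v h, hat_pt v h]
  split_ifs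
  · rw [abs_sub_comm]; apply le_of_eq; congr 1; ring
  · exact le_rfl
  · simp

lemma hat_vertex_self (v : X) : hat v (vertex v) = 1 := by simp [hat]

/-- The points of the open unit ball around a vertex. -/
lemma cases_of_dist_vertex_lt_one {a : OGraph X} {v : X} (h : dist a (vertex v) < 1) :
    a = vertex v ∨ (∃ y hy t ht, a = edge v y hy t ht) ∨
      ∃ y hy t ht, a = edge y v hy t ht ∧ 1 - t ≤ dist a (vertex v) := by
  have key := abs_hat_sub_le v a (vertex v)
  rw [hat_vertex_self, abs_sub_comm] at key
  have key' := (le_abs_self _).trans key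
  cases a with
  | vertex x =>
    by_cases hx : x = v
    · exact Or.inl (by rw [hx])
    · simp only [hat, hx, if_false] at key'; linarith
  | edge x y hxy t ht =>
    by_cases hx : x = v
    · subst hx; exact Or.inr (Or.inl ⟨y, hxy, t, ht, rfl⟩)
    by_cases hy : y = v
    · subst hy
      simp only [hat, hx, if_false, if_true] at key'
      exact Or.inr (Or.inr ⟨x, hxy, t, ht, rfl, key'⟩)
    · simp only [hat, hx, hy, if_false] at key'; linarith

lemma eq_of_dist_vertex_lt_one {x v : X} (h : dist (vertex x) (vertex v) < 1) : x = v := by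
  rcases cases_of_dist_vertex_lt_one h with h | ⟨_, _, _, _, h⟩ | ⟨_, _, _, _, h, _⟩
  · exact vertex.inj h
  · cases h
  · cases h

lemma abs_sub_le_dist_edge {x y : X} (h : x ≠ y) {t s : ℝ} (ht : t ∈ Ioo (0 : ℝ) 1)
    (hs : s ∈ Ioo (0 : ℝ) 1) : |t - s| ≤ dist (edge x y h t ht) (edge x y h s hs) := by
  simpa [hat, h] using abs_hat_sub_le y (edge x y h t ht) (edge x y h s hs)

open Classical in
/-- The distance to the set of vertices on the edge `(u, w)`, and zero off this edge. -/
noncomputable def tent (u w : X) : OGraph X → ℝ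
  | vertex _ => 0
  | edge x y _ t _ => if x = u ∧ y = w then min t (1 - t) else 0

open Classical in
lemma tent_pt (u w : X) {x y : X} (h : x ≠ y) (t : Icc (0 : ℝ) 1) :
    tent u w (pt x y t) = if x = u ∧ y = w then min (t : ℝ) (1 - t) else 0 := by
  rcases pt_cases x y h t with ⟨h0, h1⟩ | ⟨h0, h1⟩ | ⟨h0, h1⟩
  · rw [h1, h0]; simp [tent]
  · rw [h1, h0]; simp [tent]
  · rw [h1]; rfl

lemma abs_tent_sub_le (u w : X) (a b : OGraph X) : |tent u w a - tent u w b| ≤ dist a b := by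
  classical
  refine abs_sub_le_dist ?_ a b
  rintro b c r ⟨x, y, h, t, s, rfl, rfl, rfl⟩
  rw [tent_pt u w h, tent_pt u w h]
  split_ifs
  · refine (abs_min_sub_min_le_max _ _ _ _).trans (max_le le_rfl ?_)
    rw [abs_sub_comm]; apply le_of_eq; congr 1; ring
  · simp

/-- A point close to an inner point of an edge lies inside the same edge. -/
lemma exists_eq_edge_of_dist_lt {u w : X} {h : u ≠ w} {t : ℝ} {ht : t ∈ Ioo (0 : ℝ) 1}
    {b : OGraph X} (hb : dist b (edge u w h t ht) < min t (1 - t)) :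
    ∃ s hs, b = edge u w h s hs := by
  have key := abs_tent_sub_le u w b (edge u w h t ht)
  rw [abs_sub_comm] at key
  have key' := (le_abs_self _).trans key
  cases b with
  | vertex x => simp only [tent, and_self, if_true] at key'; linarith
  | edge x y hxy s hs =>
    by_cases hx : x = u ∧ y = w
    · obtain ⟨rfl, rfl⟩ := hx
      exact ⟨s, hs, rfl⟩
    · simp only [tent, hx, and_self, if_true, if_false] at key'; linarith

lemma min_pos_of_mem_Ioo {t : ℝ} (ht : t ∈ Ioo (0 : ℝ) 1) : 0 < min t (1 - t) :=
  lt_min ht.1 (sub_pos.2 ht.2)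

/-- A Cauchy sequence either stays in a compact part of one edge, or comes arbitrarily close to the
vertices, and then to only one of them because vertices are at mutual distance one. -/
instance : CompleteSpace (OGraph X) := by
  refine Metric.complete_of_cauchySeq_tendsto fun a ha => ?_
  rw [Metric.cauchySeq_iff'] at ha
  by_cases hc : ∃ (K : ℕ) (x y : X) (h : x ≠ y) (t : ℝ) (ht : t ∈ Ioo (0 : ℝ) 1) (r : ℝ),
      a K = edge x y h t ht ∧ r < min t (1 - t) ∧ ∀ k ≥ K, dist (a k) (a K) ≤ r
  · obtain ⟨K, x, y, h, t, ht, r, hK, hr, hk⟩ := hc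
    have hex : ∀ k, ∃ s hs, a (K + k) = edge x y h s hs := fun k =>
      exists_eq_edge_of_dist_lt (ht := ht)
        (by rw [← hK]; exact (hk _ (Nat.le_add_right K k)).trans_lt hr)
    choose s hs has using hex
    have hsr : ∀ k, |s k - t| ≤ r := fun k => by
      have := hk _ (Nat.le_add_right K k)
      rw [has, hK] at this
      exact (abs_sub_le_dist_edge h (hs k) ht).trans this
    have hcs : CauchySeq s := by
      rw [Metric.cauchySeq_iff']
      intro ε hε
      obtain ⟨N, hN⟩ := ha (ε / 2) (half_pos hε)
      refine ⟨N, fun n hn => ?_⟩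
      have h1 := hN (K + n) (by omega)
      have h2 := hN (K + N) (by omega)
      rw [dist_comm] at h2
      have h3 := abs_sub_le_dist_edge h (hs n) (hs N)
      rw [← has, ← has] at h3
      rw [Real.dist_eq]
      linarith [dist_triangle (a (K + n)) (a N) (a (K + N))]
    obtain ⟨c, hc⟩ := cauchySeq_tendsto_of_complete hcs
    have hcr : |c - t| ≤ r :=
      le_of_tendsto ((hc.sub_const t).abs) (Eventually.of_forall hsr)
    rw [abs_le] at hcr
    have hmin1 := min_le_left t (1 - t)
    have hmin2 := min_le_right t (1 - t)
    have hcI : c ∈ Ioo (0 : ℝ) 1 := ⟨by linarith, by linarith⟩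
    refine ⟨edge x y h c hcI, ?_⟩
    rw [← tendsto_add_atTop_iff_nat K, tendsto_iff_dist_tendsto_zero]
    have h0 : Tendsto (fun k => |s k - c|) atTop (𝓝 0) := by
      simpa using ((hc.sub_const c).abs)
    refine squeeze_zero (fun _ => dist_nonneg) (fun k => ?_) h0
    rw [add_comm k K, has k, ← pt_edge x y h _ (hs k), ← pt_edge x y h _ hcI]
    exact dist_pt_le h _ _
  · have near : ∀ ε > 0, ∃ v, ∃ N, ∀ n ≥ N, dist (a n) (vertex v) < ε := by
      intro ε hε
      obtain ⟨N, hN⟩ := ha (ε / 2) (half_pos hε)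
      have hv : ∃ v, dist (a N) (vertex v) ≤ ε / 2 := by
        cases hb : a N with
        | vertex x => exact ⟨x, by rw [dist_self]; exact (half_pos hε).le⟩
        | edge x y h t ht =>
          have hle : min t (1 - t) ≤ ε / 2 := by
            by_contra hlt
            exact hc ⟨N, x, y, h, t, ht, ε / 2, hb, not_le.1 hlt, fun k hk => (hN k hk).le⟩
          rcases min_le_iff.1 hle with hle | hle
          · exact ⟨x, (dist_edge_vertex_left_le h t ht).trans hle⟩
          · exact ⟨y, (dist_edge_vertex_right_le h t ht).trans hle⟩
      obtain ⟨v, hv⟩ := hv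
      exact ⟨v, N, fun n hn => (dist_triangle _ (a N) _).trans_lt
        (by linarith [hN n hn])⟩
    obtain ⟨v, N, hN⟩ := near (1 / 2) (by norm_num)
    refine ⟨vertex v, Metric.tendsto_atTop.2 fun ε hε => ?_⟩
    obtain ⟨w, M, hM⟩ := near (min ε (1 / 2)) (by positivity)
    have hwv : w = v := by
      refine eq_of_dist_vertex_lt_one ((dist_triangle _ (a (max N M)) _).trans_lt ?_)
      have h1 := hN (max N M) (le_max_left _ _)
      have h2 := (hM (max N M) (le_max_right _ _)).trans_le (min_le_right _ _)
      rw [dist_comm] at h2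
      linarith
    subst hwv
    exact ⟨M, fun n hn => (hM n hn).trans_le (min_le_left _ _)⟩

end OGraph

/-! ### Geometry of the cobweb -/

open OGraph

section Cobweb

variable {P : PremetricSpace.{u}}

lemma vertex_mem_cobwebSet (x : P.carrier) : vertex x ∈ cobwebSet P :=
  ⟨x, x, ⟨0, by simp⟩, (pt_vertex_left x x).symm, by simp⟩

lemma edge_mem_cobwebSet_iff {x y : P.carrier} {h : x ≠ y} {t : ℝ} {ht : t ∈ Ioo (0 : ℝ) 1} :
    edge x y h t ht ∈ cobwebSet P ↔ t ≤ 1 - min 1 (P.d y x) := by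
  constructor
  · rintro ⟨x', y', s, hs, hle⟩
    by_cases hxy : x' = y'
    · subst hxy
      simp only [OGraph.pt, ne_eq, not_true_eq_false, false_and, dite_false] at hs
      split_ifs at hs
    · rcases pt_cases x' y' hxy s with ⟨_, h1⟩ | ⟨_, h1⟩ | ⟨_, h1⟩
      · rw [h1] at hs; cases hs
      · rw [h1] at hs; cases hs
      · rw [h1] at hs; cases hs; exact hle
  · exact fun hle => ⟨x, y, ⟨t, ht.1.le, ht.2.le⟩, (pt_edge x y h t ht).symm, hle⟩

lemma isClosed_cobwebSet (P : PremetricSpace.{u}) : IsClosed (cobwebSet P) := by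
  rw [← isOpen_compl_iff, Metric.isOpen_iff]
  intro a ha
  cases a with
  | vertex x => exact absurd (vertex_mem_cobwebSet x) ha
  | edge x y h t ht =>
    rw [mem_compl_iff, edge_mem_cobwebSet_iff, not_le] at ha
    refine ⟨min (min t (1 - t)) (t - (1 - min 1 (P.d y x))),
      lt_min (min_pos_of_mem_Ioo ht) (sub_pos.2 ha), fun b hb => ?_⟩
    rw [Metric.mem_ball, lt_min_iff] at hb
    obtain ⟨s, hs, rfl⟩ := exists_eq_edge_of_dist_lt hb.1
    rw [mem_compl_iff, edge_mem_cobwebSet_iff, not_le]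
    have := (abs_le.1 (abs_sub_le_dist_edge h hs ht)).1
    linarith [hb.2]

instance (P : PremetricSpace.{u}) : CompleteSpace (Cobweb P) :=
  (isClosed_cobwebSet P).completeSpace_coe

/-- A point of `P` as a vertex of the cobweb. -/
def Cobweb.vertex (x : P.carrier) : Cobweb P := ⟨OGraph.vertex x, vertex_mem_cobwebSet x⟩

lemma compression_vertex (x : P.carrier) : compression P (Cobweb.vertex x) = x := rfl

lemma compression_eq_of_val_vertex {a : Cobweb P} {x : P.carrier} (h : a.1 = OGraph.vertex x) :
    compression P a = x := by
  unfold compression; rw [h]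

lemma compression_eq_of_val_edge {a : Cobweb P} {x y : P.carrier} {h : x ≠ y} {t : ℝ}
    {ht : t ∈ Ioo (0 : ℝ) 1} (ha : a.1 = edge x y h t ht) : compression P a = x := by
  unfold compression; rw [ha]

lemma compression_eq_of_val_pt {a : Cobweb P} {x y : P.carrier} (h : x ≠ y) {t : Icc (0 : ℝ) 1}
    (ha : a.1 = pt x y t) (ht : (t : ℝ) < 1) : compression P a = x := by
  rcases pt_cases x y h t with ⟨_, h1⟩ | ⟨h1, _⟩ | ⟨_, h1⟩
  · exact compression_eq_of_val_vertex (ha.trans h1)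
  · exact absurd h1 ht.ne
  · exact compression_eq_of_val_edge (ha.trans h1)

/-- Near a vertex `v` the compression map takes values `y` with small `d (v, y)`: an edge `(y, v)`
comes close to `v` only if `d (v, y)` is small. -/
lemma compression_of_dist_vertex_lt_one {a : Cobweb P} {v : P.carrier}
    (h : dist a (Cobweb.vertex v) < 1) :
    compression P a = v ∨
      compression P a ≠ v ∧ P.d v (compression P a) ≤ dist a (Cobweb.vertex v) := by
  rcases cases_of_dist_vertex_lt_one (a := a.1) h with ha | ⟨y, hy, t, ht, ha⟩ | ⟨y, hy, t, ht, ha, h1⟩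
  · exact Or.inl (compression_eq_of_val_vertex ha)
  · exact Or.inl (compression_eq_of_val_edge ha)
  · right
    rw [compression_eq_of_val_edge ha]
    refine ⟨hy, ?_⟩
    have hm : edge y v hy t ht ∈ cobwebSet P := ha ▸ a.2
    rw [edge_mem_cobwebSet_iff] at hm
    have h2 : min 1 (P.d v y) ≤ dist a (Cobweb.vertex v) := by
      have h3 : 1 - t ≤ dist a (Cobweb.vertex v) := h1
      linarith
    rcases min_le_iff.1 h2 with h3 | h3
    · linarith
    · exact h3

/-- The compression map is locally constant at the inner points of the edges. -/
lemma exists_forall_compression_eq {a : Cobweb P} (ha : ∀ v, a ≠ Cobweb.vertex v) :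
    ∃ ε > 0, ∀ b, dist b a < ε → compression P b = compression P a := by
  obtain ⟨a, hm⟩ := a
  cases a with
  | vertex v => exact absurd rfl (ha v)
  | edge x y h t ht =>
    refine ⟨min t (1 - t), min_pos_of_mem_Ioo ht, fun b hb => ?_⟩
    obtain ⟨s, hs, hbs⟩ := exists_eq_edge_of_dist_lt (b := b.1) hb
    rw [compression_eq_of_val_edge hbs]
    rfl

/-- If `d (p, q)` is less than `r`, then the star of `q` comes to the vertex `p` closer than `r`. -/
lemma exists_compression_eq_dist_lt {p q : P.carrier} {r : ℝ} (hr : r ≤ 1) (h : P.d p q < r) :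
    ∃ a : Cobweb P, compression P a = q ∧ dist a (Cobweb.vertex p) < r := by
  have h0 := P.d_nonneg p q
  by_cases hqp : q = p
  · subst hqp
    exact ⟨Cobweb.vertex q, rfl, by rw [dist_self]; linarith⟩
  · have ht : 1 - (P.d p q + r) / 2 ∈ Ioo (0 : ℝ) 1 := ⟨by linarith, by linarith⟩
    refine ⟨⟨edge q p hqp _ ht, edge_mem_cobwebSet_iff.2 ?_⟩, rfl, ?_⟩
    · linarith [min_le_right 1 (P.d p q)]
    · exact (dist_edge_vertex_right_le hqp _ ht).trans_lt (by linarith)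

/-- The initial piece `{⟨x, y, τ⟩ : τ ≤ t}` of an edge of the cobweb is connected. -/
lemma exists_isPreconnected_segment {x y : P.carrier} (h : x ≠ y) {t : ℝ} (ht : t ∈ Icc (0 : ℝ) 1)
    (hle : t ≤ 1 - min 1 (P.d y x)) :
    ∃ S : Set (Cobweb P), IsPreconnected S ∧
      ∀ a, a ∈ S ↔ ∃ τ : Icc (0 : ℝ) 1, (τ : ℝ) ≤ t ∧ a.1 = pt x y τ := by
  let g : Icc (0 : ℝ) t → Cobweb P := fun τ =>
    ⟨pt x y ⟨τ, τ.2.1, τ.2.2.trans ht.2⟩, x, y, _, rfl, τ.2.2.trans hle⟩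
  have hg : Continuous g := by
    refine (LipschitzWith.of_dist_le_mul (K := 1) fun τ σ => ?_).continuous
    rw [NNReal.coe_one, one_mul]
    exact dist_pt_le h _ _
  have : PreconnectedSpace (Icc (0 : ℝ) t) := Subtype.preconnectedSpace isPreconnected_Icc
  refine ⟨range g, isPreconnected_range hg, fun a => ⟨?_, ?_⟩⟩
  · rintro ⟨τ, rfl⟩
    exact ⟨_, τ.2.2, rfl⟩
  · rintro ⟨τ, hτ, ha⟩
    exact ⟨⟨τ, τ.2.1, hτ⟩, Subtype.ext ha.symm⟩

lemma isPreconnected_compression_fiber (x : P.carrier) :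
    IsPreconnected (compression P ⁻¹' {x}) := by
  refine isPreconnected_of_forall (Cobweb.vertex x) ?_
  rintro ⟨a, hm⟩ ha
  cases a with
  | vertex v =>
    obtain rfl : v = x := ha
    exact ⟨{Cobweb.vertex v}, by simp [compression_vertex], rfl, rfl, isPreconnected_singleton⟩
  | edge v y h t ht =>
    obtain rfl : v = x := ha
    obtain ⟨S, hS, hmem⟩ := exists_isPreconnected_segment h ⟨ht.1.le, ht.2.le⟩
      (edge_mem_cobwebSet_iff.1 hm)
    refine ⟨S, fun b hb => ?_, ?_, ?_, hS⟩
    · obtain ⟨τ, hτ, hb⟩ := (hmem b).1 hb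
      exact compression_eq_of_val_pt h hb (hτ.trans_lt ht.2)
    · exact (hmem _).2 ⟨⟨0, by simp⟩, ht.1.le, (pt_vertex_left _ _).symm⟩
    · exact (hmem _).2 ⟨⟨t, ht.1.le, ht.2.le⟩, le_rfl, (pt_edge _ _ h t ht).symm⟩

/-- Points at distance zero in `P` are joined by complete edges in the cobweb. -/
lemma isPreconnected_compression_preimage {F : Set P.carrier}
    (hF : ∀ p ∈ F, ∀ q ∈ F, P.d p q = 0) : IsPreconnected (compression P ⁻¹' F) := by
  rcases F.eq_empty_or_nonempty with rfl | ⟨p, hp⟩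
  · simpa using isPreconnected_empty
  refine isPreconnected_of_forall (Cobweb.vertex p) fun a ha => ?_
  by_cases hpq : p = compression P a
  · refine ⟨_, preimage_mono (singleton_subset_iff.2 hp), rfl, hpq.symm,
      isPreconnected_compression_fiber p⟩
  · obtain ⟨S, hS, hmem⟩ := exists_isPreconnected_segment hpq (t := 1) (by simp)
      (by rw [hF _ ha _ hp]; simp)
    have hq : Cobweb.vertex (compression P a) ∈ S :=
      (hmem _).2 ⟨⟨1, by simp⟩, le_rfl, (pt_vertex_right _ _).symm⟩
    refine ⟨S ∪ compression P ⁻¹' {compression P a}, ?_, ?_, Or.inr rfl,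
      hS.union _ hq rfl (isPreconnected_compression_fiber _)⟩
    · rintro b (hb | hb)
      · obtain ⟨τ, hτ, hb⟩ := (hmem b).1 hb
        rcases hτ.lt_or_eq with hτ | hτ
        · rw [mem_preimage, compression_eq_of_val_pt hpq hb hτ]; exact hp
        · obtain rfl : τ = ⟨1, by simp⟩ := Subtype.ext hτ
          rw [pt_vertex_right] at hb
          rw [mem_preimage, compression_eq_of_val_vertex hb]; exact ha
      · rw [mem_preimage, show compression P b = _ from hb]; exact ha
    · exact Or.inl ((hmem _).2 ⟨⟨0, by simp⟩, zero_le_one, (pt_vertex_left _ _).symm⟩)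

end Cobweb

/-! ### The compression map over a metric space -/

section Metric

variable {Q : Type u} [MetricSpace Q]

/-- The value at `m` of the path that leaves `α` at unit speed towards `β` and stops there. -/
def approach (α β m : ℝ) : ℝ := max (α - m) (min (α + m) β)

lemma approach_zero (α β : ℝ) : approach α β 0 = α := by
  simp [approach]

lemma approach_eq_right {α β m : ℝ} (h : |α - β| ≤ m) : approach α β m = β := by
  rw [abs_le] at h
  rw [approach, min_eq_right (by linarith), max_eq_right (by linarith)]

lemma abs_approach_sub_le (α β m n : ℝ) : |approach α β m - approach α β n| ≤ |m - n| := by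
  unfold approach
  refine (abs_max_sub_max_le_max _ _ _ _).trans (max_le ?_ ?_)
  · rw [abs_sub_comm m]; apply le_of_eq; congr 1; ring
  · refine (abs_min_sub_min_le_max _ _ _ _).trans (max_le ?_ ?_)
    · apply le_of_eq; congr 1; ring
    · simp

/-- A function on the complete oriented graph of a metric space that takes the value
`min 1 (dist x q)` at each vertex `x`, and on each edge `(x, y)` stays constant as long as the edge
runs inside the cobweb. -/
noncomputable def truncDist (q : Q) : OGraph Q → ℝ
  | vertex x => min 1 (dist x q)
  | edge x y _ t _ =>
    approach (min 1 (dist x q)) (min 1 (dist y q)) (max 0 (t - (1 - min 1 (dist y x))))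

lemma abs_min_one_dist_sub_le (x y q : Q) :
    |min 1 (dist x q) - min 1 (dist y q)| ≤ min 1 (dist y x) := by
  refine le_min ?_ ?_
  · rw [abs_le]
    have h1 : 0 ≤ min 1 (dist x q) := le_min zero_le_one dist_nonneg
    have h2 : 0 ≤ min 1 (dist y q) := le_min zero_le_one dist_nonneg
    constructor <;> linarith [min_le_left 1 (dist x q), min_le_left 1 (dist y q)]
  · refine (abs_min_sub_min_le_max _ _ _ _).trans (max_le (by simp) ?_)
    rw [dist_comm y x]
    exact abs_dist_sub_le x y q

lemma truncDist_pt (q : Q) {x y : Q} (h : x ≠ y) (t : Icc (0 : ℝ) 1) :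
    truncDist q (pt x y t) = approach (min 1 (dist x q)) (min 1 (dist y q))
      (max 0 ((t : ℝ) - (1 - min 1 (dist y x)))) := by
  rcases pt_cases x y h t with ⟨h0, h1⟩ | ⟨h0, h1⟩ | ⟨h0, h1⟩
  · rw [h1, h0, max_eq_left (by linarith [min_le_left 1 (dist y x)]), approach_zero]
    rfl
  · rw [h1, h0, sub_sub_cancel, max_eq_right (le_min zero_le_one dist_nonneg),
      approach_eq_right (abs_min_one_dist_sub_le x y q)]
    rfl
  · rw [h1]; rfl

lemma abs_truncDist_sub_le (q : Q) (a b : OGraph Q) :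
    |truncDist q a - truncDist q b| ≤ dist a b := by
  refine abs_sub_le_dist ?_ a b
  rintro b c r ⟨x, y, h, t, s, rfl, rfl, rfl⟩
  rw [truncDist_pt q h, truncDist_pt q h]
  refine (abs_approach_sub_le _ _ _ _).trans ?_
  refine (abs_max_sub_max_le_max _ _ _ _).trans (max_le (by simp) ?_)
  simp

lemma truncDist_eq (q : Q) (a : Cobweb (PremetricSpace.ofMetric Q)) :
    truncDist q a.1 = min 1 (dist (show Q from compression _ a) q) := by
  obtain ⟨a, hm⟩ := a
  cases a with
  | vertex v => rfl
  | edge x y h t ht =>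
    have h1 : t ≤ 1 - min 1 (dist (α := Q) y x) := edge_mem_cobwebSet_iff.1 hm
    change approach (min 1 (dist (α := Q) x q)) (min 1 (dist (α := Q) y q))
      (max 0 (t - (1 - min 1 (dist (α := Q) y x)))) = min 1 (dist (α := Q) x q)
    rw [max_eq_left (by linarith), approach_zero]

/-- The compression map does not increase distances less than one. -/
lemma min_one_dist_compression_le (a b : Cobweb (PremetricSpace.ofMetric Q)) :
    min 1 (dist (show Q from compression _ a) (show Q from compression _ b)) ≤ dist a b := by
  have h := abs_truncDist_sub_le (show Q from compression _ b) a.1 b.1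
  rw [truncDist_eq, truncDist_eq, dist_self, min_eq_right zero_le_one, sub_zero] at h
  exact (le_abs_self _).trans h

lemma dist_compression_le {a b : Cobweb (PremetricSpace.ofMetric Q)} (h : dist a b < 1) :
    dist (show Q from compression _ a) (show Q from compression _ b) ≤ dist a b := by
  rcases min_le_iff.1 (min_one_dist_compression_le a b) with h1 | h1
  · linarith
  · exact h1

lemma continuous_compression :
    Continuous (fun a : Cobweb (PremetricSpace.ofMetric Q) => (show Q from compression _ a)) := by
  refine Metric.continuous_iff.2 fun a ε hε => ⟨min ε 1, by positivity, fun b hb => ?_⟩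
  rw [lt_min_iff] at hb
  exact (dist_compression_le hb.2).trans_lt hb.1

end Metric

/-! ### The limit of the iterated cobwebs -/

namespace CobwebLimit

variable {P : PremetricSpace.{u}}

/-- The compression map between consecutive iterated cobwebs. -/
noncomputable def bond (P : PremetricSpace.{u}) (n : ℕ) (a : Cobweb (iter P (n + 1))) : Cobweb (iter P n) :=
  compression (iter P (n + 1)) a

/-- A point of an iterated cobweb as a vertex of the next one. -/
noncomputable def up {n : ℕ} (a : Cobweb (iter P n)) : Cobweb (iter P (n + 1)) :=
  Cobweb.vertex (P := iter P (n + 1)) a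

lemma bond_coe (a : CobwebLimit P) (n : ℕ) : bond P n (a.1 (n + 1)) = a.1 n := a.2 n

lemma dist_bond_le {n : ℕ} {a b : Cobweb (iter P (n + 1))} (h : dist a b < 1) :
    dist (bond P n a) (bond P n b) ≤ dist a b :=
  dist_compression_le (Q := Cobweb (iter P n)) h

lemma continuous_bond (n : ℕ) : Continuous (bond P n) :=
  continuous_compression (Q := Cobweb (iter P n))

lemma isPreconnected_bond_fiber (n : ℕ) (a : Cobweb (iter P n)) :
    IsPreconnected (bond P n ⁻¹' {a}) :=
  isPreconnected_compression_fiber (P := iter P (n + 1)) a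

lemma exists_bond_eq_dist_lt {n : ℕ} {a b : Cobweb (iter P n)} {r : ℝ} (hr : r ≤ 1)
    (h : dist b a < r) : ∃ c, bond P n c = b ∧ dist c (up a) < r :=
  exists_compression_eq_dist_lt (P := iter P (n + 1)) hr (by rw [dist_comm] at h; exact h)

lemma dist_coord_le (a b : CobwebLimit P) (n : ℕ) :
    dist (a.1 n) (b.1 n) ≤ ((n : ℝ) + 1) * dist a b := by
  have h := le_ciSup (bddAbove_limit a b) n
  have h1 : (0 : ℝ) < (n : ℝ) + 1 := by positivity
  change 1 / ((n : ℝ) + 1) * dist (a.1 n) (b.1 n) ≤ dist a b at h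
  rwa [one_div, inv_mul_le_iff₀ h1] at h

lemma dist_le_of_forall {a b : CobwebLimit P} {r : ℝ}
    (h : ∀ n : ℕ, 1 / ((n : ℝ) + 1) * dist (a.1 n) (b.1 n) ≤ r) : dist a b ≤ r :=
  ciSup_le h

lemma dist_coord_le_three (a b : CobwebLimit P) (n : ℕ) : dist (a.1 n) (b.1 n) ≤ 3 :=
  OGraph.dist_le_three (a.1 n).1 (b.1 n).1

lemma one_div_mul_dist_le (a b : CobwebLimit P) (n : ℕ) :
    1 / ((n : ℝ) + 1) * dist (a.1 n) (b.1 n) ≤ dist (a.1 n) (b.1 n) := by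
  refine mul_le_of_le_one_left dist_nonneg ?_
  rw [div_le_one (by positivity)]
  linarith [Nat.cast_nonneg (α := ℝ) n]

lemma one_div_mul_dist_le_three (a b : CobwebLimit P) (n : ℕ) :
    1 / ((n : ℝ) + 1) * dist (a.1 n) (b.1 n) ≤ 3 / ((n : ℝ) + 1) := by
  have h := mul_le_mul_of_nonneg_left (dist_coord_le_three a b n)
    (show (0 : ℝ) ≤ 1 / ((n : ℝ) + 1) by positivity)
  rwa [one_div_mul_eq_div _ (3 : ℝ)] at h

lemma lipschitzWith_coord (n : ℕ) :
    LipschitzWith ((n + 1 : ℕ) : NNReal) fun a : CobwebLimit P => a.1 n :=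
  LipschitzWith.of_dist_le_mul fun a b => by simpa using dist_coord_le a b n

lemma continuous_coord (n : ℕ) : Continuous fun a : CobwebLimit P => a.1 n :=
  (lipschitzWith_coord n).continuous

lemma dist_coord_le_of_le {a b : CobwebLimit P} {n N : ℕ} (hn : n ≤ N)
    (h : dist (a.1 N) (b.1 N) < 1) : dist (a.1 n) (b.1 n) ≤ dist (a.1 N) (b.1 N) := by
  induction N, hn using Nat.le_induction with
  | base => exact le_rfl
  | succ N hN ih =>
    have h1 := dist_bond_le h
    rw [bond_coe, bond_coe] at h1
    exact (ih (h1.trans_lt h)).trans h1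

lemma coord_eq_of_le {a b : CobwebLimit P} {n N : ℕ} (hn : n ≤ N) (h : a.1 N = b.1 N) :
    a.1 n = b.1 n := by
  have h1 := dist_coord_le_of_le (a := a) (b := b) hn (by rw [h, dist_self]; exact zero_lt_one)
  rw [h, dist_self] at h1
  exact dist_le_zero.1 h1

lemma exists_three_div_lt {ε : ℝ} (hε : 0 < ε) : ∃ N : ℕ, ∀ n ≥ N, 3 / ((n : ℝ) + 1) < ε := by
  obtain ⟨N, hN⟩ := exists_nat_gt (3 / ε)
  refine ⟨N, fun n hn => ?_⟩
  have h1 : (N : ℝ) ≤ n := Nat.cast_le.2 hn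
  rw [div_lt_iff₀ hε] at hN
  rw [div_lt_iff₀ (by positivity)]
  nlinarith

/-- Every neighbourhood of a thread contains all threads that agree with it up to a far
coordinate. -/
lemma exists_forall_coord_eq_mem {a : CobwebLimit P} {U : Set (CobwebLimit P)} (hU : U ∈ 𝓝 a) :
    ∃ N, ∀ n ≥ N, ∀ b : CobwebLimit P, b.1 n = a.1 n → b ∈ U := by
  obtain ⟨ε, hε, hεU⟩ := Metric.mem_nhds_iff.1 hU
  obtain ⟨N, hN⟩ := exists_three_div_lt (half_pos hε)
  refine ⟨N, fun n hn b hb => hεU (lt_of_le_of_lt (dist_le_of_forall fun m => ?_) (half_lt_self hε))⟩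
  rcases le_total m n with hmn | hmn
  · rw [coord_eq_of_le hmn hb, dist_self, mul_zero]
    exact (half_pos hε).le
  · exact (one_div_mul_dist_le_three b a m).trans (hN m (hn.trans hmn)).le

instance : CompleteSpace (CobwebLimit P) := by
  refine Metric.complete_of_cauchySeq_tendsto fun a ha => ?_
  have hc : ∀ n, CauchySeq fun k => (a k).1 n := fun n =>
    ha.map (lipschitzWith_coord n).uniformContinuous
  choose l hl using fun n => cauchySeq_tendsto_of_complete (hc n)
  have hlim : ∀ n, bond P n (l (n + 1)) = l n := fun n => by
    refine tendsto_nhds_unique (((continuous_bond n).tendsto _).comp (hl (n + 1))) ?_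
    simpa only [Function.comp_def, bond_coe] using hl n
  refine ⟨⟨l, hlim⟩, Metric.tendsto_atTop.2 fun ε hε => ?_⟩
  obtain ⟨M, hM⟩ := Metric.cauchySeq_iff.1 ha (ε / 2) (half_pos hε)
  refine ⟨M, fun k hk => lt_of_le_of_lt (dist_le_of_forall fun n => ?_) (half_lt_self hε)⟩
  refine le_of_tendsto ((tendsto_const_nhds.dist (hl n)).const_mul _)
    (eventually_atTop.2 ⟨M, fun j hj => ?_⟩)
  exact (le_ciSup (bddAbove_limit (a k) (a j)) n).trans (hM k hk j hj).le

/-- Sections of the bonding maps extend each point of an iterated cobweb to a thread. -/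
lemma exists_thread_of_sections (n : ℕ) : ∀ (F : ∀ m, Cobweb (iter P m) → Cobweb (iter P (m + 1)))
    (_ : ∀ m x, bond P m (F m x) = x) (s : Cobweb (iter P n)),
    ∃ a : CobwebLimit P, a.1 n = s ∧ ∀ m ≥ n, a.1 (m + 1) = F m (a.1 m) := by
  classical
  induction n with
  | zero =>
    intro F hF s
    refine ⟨⟨fun m => Nat.rec (motive := fun m => Cobweb (iter P m)) s F m, fun m => hF m _⟩, rfl,
      fun m _ => rfl⟩
  | succ n ih =>
    intro F hF s
    -- Redefine the section at level `n` so that it passes through `s`.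
    obtain ⟨a, ha, ha'⟩ := ih
      (Function.update F n (Function.update (F n) (bond P n s) s)) (fun m x => by
        by_cases hm : m = n
        · subst hm
          rw [Function.update_self]
          by_cases hx : x = bond P m s
          · subst hx; rw [Function.update_self]
          · rw [Function.update_of_ne hx, hF]
        · rw [Function.update_of_ne hm, hF]) (bond P n s)
    refine ⟨a, ?_, fun m hm => ?_⟩
    · rw [ha' n le_rfl, Function.update_self, ha, Function.update_self]
    · rw [ha' m (by omega), Function.update_of_ne (by omega)]

/-- A property that can be preserved in passing to the next level holds along some thread. -/
lemma exists_thread (n : ℕ) (T : ∀ m, Cobweb (iter P m) → Prop)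
    (hT : ∀ m ≥ n, ∀ x, T m x → ∃ y, bond P m y = x ∧ T (m + 1) y) {s : Cobweb (iter P n)}
    (hs : T n s) : ∃ a : CobwebLimit P, a.1 n = s ∧ ∀ m ≥ n, T m (a.1 m) := by
  have hF : ∀ m x, ∃ y, bond P m y = x ∧ (m ≥ n → T m x → T (m + 1) y) := by
    intro m x
    by_cases h : m ≥ n ∧ T m x
    · obtain ⟨y, hy, hy'⟩ := hT m h.1 x h.2
      exact ⟨y, hy, fun _ _ => hy'⟩
    · exact ⟨up x, rfl, fun h1 h2 => absurd ⟨h1, h2⟩ h⟩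
  choose F hF hF' using hF
  obtain ⟨a, ha, ha'⟩ := exists_thread_of_sections n F hF s
  refine ⟨a, ha, fun m hm => ?_⟩
  induction m, hm using Nat.le_induction with
  | base => rw [ha]; exact hs
  | succ m hm ih => rw [ha' m hm]; exact hF' m _ hm ih

/-- A thread is vertical from the level `n` on if each of its later coordinates is the preceding one
regarded as a vertex of the next cobweb. -/
def IsVertical (n : ℕ) (a : CobwebLimit P) : Prop := ∀ m ≥ n, a.1 (m + 1) = up (a.1 m)

lemma exists_isVertical {n : ℕ} (s : Cobweb (iter P n)) :
    ∃ a : CobwebLimit P, a.1 n = s ∧ IsVertical n a :=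
  exists_thread_of_sections n (fun _ => up) (fun _ _ => rfl) s

/-- The projection to a coordinate is open at the threads that are vertical from there on. -/
lemma IsVertical.exists_dist_le {n : ℕ} {a : CobwebLimit P} (ha : IsVertical n a)
    {s : Cobweb (iter P n)} {r : ℝ} (hr : r ≤ 1) (h : dist s (a.1 n) < r) :
    ∃ b : CobwebLimit P, b.1 n = s ∧ dist b a ≤ r := by
  obtain ⟨b, hb, hb'⟩ := exists_thread n (fun m x => dist x (a.1 m) < r) (fun m hm x hx => by
    rw [ha m hm]; exact exists_bond_eq_dist_lt hr hx) h
  refine ⟨b, hb, dist_le_of_forall fun m => (one_div_mul_dist_le b a m).trans ?_⟩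
  rcases le_total n m with hm | hm
  · exact (hb' m hm).le
  · exact (dist_coord_le_of_le hm ((hb' n le_rfl).trans_le hr)).trans (hb' n le_rfl).le

/-- If `u` and `v` are disjoint open sets that cover the preimage of a connected set `A` and both
meet it, then both meet the fibre over one point of `A`: otherwise the projections of `u` and `v`
would separate `A`, since the projection is open at vertical threads. -/
lemma exists_fiber_meets_both {n : ℕ} {A : Set (Cobweb (iter P n))} (hA : IsPreconnected A)
    {u v : Set (CobwebLimit P)} (hu : IsOpen u) (hv : IsOpen v)
    (hcov : ∀ a : CobwebLimit P, a.1 n ∈ A → a ∈ u ∪ v)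
    (hau : ∃ a ∈ u, a.1 n ∈ A) (hav : ∃ a ∈ v, a.1 n ∈ A) :
    ∃ p ∈ A, (∃ a ∈ u, a.1 n = p) ∧ ∃ a ∈ v, a.1 n = p := by
  have key : ∀ w w' : Set (CobwebLimit P), IsOpen w →
      (∀ a : CobwebLimit P, a.1 n ∈ A → a ∈ w ∪ w') → ∀ p ∈ A, (¬ ∃ a ∈ w', a.1 n = p) →
      ∀ᶠ s in 𝓝 p, ∃ a ∈ w, a.1 n = s := by
    intro w w' hw hcov p hp hpw'
    obtain ⟨a, hap, ha⟩ := exists_isVertical p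
    have haw : a ∈ w := (hcov a (hap ▸ hp)).resolve_right fun h => hpw' ⟨a, h, hap⟩
    obtain ⟨ε, hε, hεw⟩ := Metric.isOpen_iff.1 hw a haw
    filter_upwards [Metric.ball_mem_nhds p (show 0 < min 1 (ε / 2) by positivity)] with s hs
    obtain ⟨b, hb, hba⟩ := ha.exists_dist_le (min_le_left 1 (ε / 2)) (hap ▸ hs)
    refine ⟨b, hεw ?_, hb⟩
    rw [Metric.mem_ball]
    linarith [min_le_right 1 (ε / 2)]
  by_contra hno
  push Not at hno
  have hno' : ∀ p ∈ A, (∃ a ∈ u, a.1 n = p) → ¬ ∃ a ∈ v, a.1 n = p := fun p hp h1 ⟨a, h2, h3⟩ =>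
    hno p hp h1 a h2 h3
  have hmem : ∀ p ∈ A, (∃ a ∈ u, a.1 n = p) ∨ ∃ a ∈ v, a.1 n = p := fun p hp => by
    obtain ⟨a, rfl, -⟩ := exists_isVertical p
    exact (hcov a hp).imp (fun h => ⟨a, h, rfl⟩) (fun h => ⟨a, h, rfl⟩)
  have hcov' : ∀ a : CobwebLimit P, a.1 n ∈ A → a ∈ v ∪ u := fun a ha => (hcov a ha).symm
  have h1 : ∀ p ∈ A, (∃ a ∈ u, a.1 n = p) → p ∈ {p | ∀ᶠ s in 𝓝 p, ∃ a ∈ u, a.1 n = s} :=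
    fun p hp h => key u v hu hcov p hp (hno' p hp h)
  have h2 : ∀ p ∈ A, (∃ a ∈ v, a.1 n = p) → p ∈ {p | ∀ᶠ s in 𝓝 p, ∃ a ∈ v, a.1 n = s} :=
    fun p hp h => key v u hv hcov' p hp fun h' => hno' p hp h' h
  obtain ⟨a, hau, haA⟩ := hau
  obtain ⟨b, hbv, hbA⟩ := hav
  obtain ⟨p, hpA, hpu, hpv⟩ := hA _ _ isOpen_setOfPred_eventually_nhds isOpen_setOfPred_eventually_nhds
    (fun p hp => (hmem p hp).imp (h1 p hp) (h2 p hp)) ⟨_, haA, h1 _ haA ⟨a, hau, rfl⟩⟩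
    ⟨_, hbA, h2 _ hbA ⟨b, hbv, rfl⟩⟩
  exact hno' p hpA (Eventually.self_of_nhds (p := fun s => ∃ a ∈ u, a.1 n = s) hpu)
    (Eventually.self_of_nhds (p := fun s => ∃ a ∈ v, a.1 n = s) hpv)

/-- A separation of the preimage of `A` would separate the fibre over some `p ∈ A`, then the fibre
over some point of the star of `p`, and so on; the thread obtained in this way has no neighbourhood
inside one part of the separation. -/
lemma isPreconnected_coord_preimage {n : ℕ} {A : Set (Cobweb (iter P n))} (hA : IsPreconnected A) :
    IsPreconnected {a : CobwebLimit P | a.1 n ∈ A} := by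
  rintro u v hu hv hcov ⟨a, haA, hau⟩ ⟨b, hbA, hbv⟩
  by_contra hdis
  have hdis' : ∀ a : CobwebLimit P, a.1 n ∈ A → a ∈ u → a ∉ v := fun a h1 h2 h3 =>
    hdis ⟨a, h1, h2, h3⟩
  obtain ⟨p, hpA, hp⟩ := exists_fiber_meets_both hA hu hv (fun a ha => hcov ha)
    ⟨a, hau, haA⟩ ⟨b, hbv, hbA⟩
  obtain ⟨c, hc, hc'⟩ := exists_thread n
    (fun m x => (∀ a : CobwebLimit P, a.1 m = x → a.1 n ∈ A) ∧
      (∃ a ∈ u, a.1 m = x) ∧ ∃ a ∈ v, a.1 m = x)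
    (fun m _ x ⟨hxA, ⟨a, hau, hax⟩, ⟨b, hbv, hbx⟩⟩ => by
      have hx : ∀ a : CobwebLimit P, bond P m (a.1 (m + 1)) = x → a.1 n ∈ A := fun a ha =>
        hxA a (by rw [← bond_coe, ha])
      obtain ⟨y, hy, hyu, hyv⟩ := exists_fiber_meets_both (isPreconnected_bond_fiber m x) hu hv
        (fun a ha => hcov (hx a ha)) ⟨a, hau, (bond_coe a m).trans hax⟩
        ⟨b, hbv, (bond_coe b m).trans hbx⟩
      exact ⟨y, hy, fun a ha => hx a (by rw [ha]; exact hy), hyu, hyv⟩)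
    ⟨fun a ha => by rw [ha]; exact hpA, hp⟩
  have hcA : c.1 n ∈ A := hc ▸ hpA
  rcases hcov hcA with h | h
  · obtain ⟨N, hN⟩ := exists_forall_coord_eq_mem (hu.mem_nhds h)
    obtain ⟨hA', -, b, hbv, hb⟩ := hc' (max n N) (le_max_left _ _)
    exact hdis' b (hA' b hb) (hN _ (le_max_right _ _) b hb) hbv
  · obtain ⟨N, hN⟩ := exists_forall_coord_eq_mem (hv.mem_nhds h)
    obtain ⟨hA', ⟨b, hbu, hb⟩, -⟩ := hc' (max n N) (le_max_left _ _)
    exact hdis' b (hA' b hb) hbu (hN _ (le_max_right _ _) b hb)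

/-- A vertical thread over `p` is approached by threads over points close to `p`. -/
lemma exists_limitCompression_eq_dist_le {a : CobwebLimit P} {p q : P.carrier}
    (hp : a.1 0 = Cobweb.vertex (P := iter P 0) p) (ha : IsVertical 0 a) {r : ℝ} (hr : r ≤ 1)
    (h : P.d p q < r) : ∃ b : CobwebLimit P, limitCompression P b = q ∧ dist b a ≤ r := by
  obtain ⟨s, hs, hsr⟩ := exists_compression_eq_dist_lt (P := P) hr h
  obtain ⟨b, hb, hba⟩ := ha.exists_dist_le (s := s) hr (by rw [hp]; exact hsr)
  refine ⟨b, ?_, hba⟩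
  unfold limitCompression
  rw [hb]
  exact hs

end CobwebLimit

/-! ### Economy -/

section Economy

variable {P : PremetricSpace.{u}}

/-- The far end of the edge through a point of the cobweb. -/
def farEnd (P : PremetricSpace.{u}) (a : Cobweb P) : P.carrier :=
  match a.1 with
  | OGraph.vertex x => x
  | OGraph.edge _ y _ _ _ => y

/-- The compression map takes on the closure of `D` only those values that are ends of edges through
points of `D`. -/
lemma exists_compression_or_farEnd_eq {D : Set (Cobweb P)} {b : Cobweb P} (hb : b ∈ closure D) :
    ∃ d ∈ D, compression P b = compression P d ∨ compression P b = farEnd P d := by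
  rw [Metric.mem_closure_iff] at hb
  by_cases h : ∃ v, b = Cobweb.vertex v
  · obtain ⟨v, rfl⟩ := h
    obtain ⟨d, hd, hbd⟩ := hb 1 one_pos
    rw [dist_comm] at hbd
    refine ⟨d, hd, ?_⟩
    rw [compression_vertex]
    rcases cases_of_dist_vertex_lt_one (a := d.1) hbd with
      ha | ⟨y, hy, t, ht, ha⟩ | ⟨y, hy, t, ht, ha, -⟩
    · exact Or.inl (compression_eq_of_val_vertex ha).symm
    · exact Or.inl (compression_eq_of_val_edge ha).symm
    · exact Or.inr (by unfold farEnd; rw [ha])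
  · obtain ⟨ε, hε, h⟩ := exists_forall_compression_eq fun v hv => h ⟨v, hv⟩
    obtain ⟨d, hd, hbd⟩ := hb ε hε
    exact ⟨d, hd, Or.inl (h d (by rwa [dist_comm])).symm⟩

namespace CobwebLimit

/-- The metric of the limit is a maximum: every distance occurs, up to the weight, at some level. -/
lemma exists_dist_eq (a b : CobwebLimit P) :
    ∃ n : ℕ, dist a b = 1 / ((n : ℝ) + 1) * dist (a.1 n) (b.1 n) := by
  by_cases h0 : dist a b = 0
  · refine ⟨0, ?_⟩
    rw [h0, dist_eq_zero.1 h0, dist_self, mul_zero]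
  have hpos : 0 < dist a b := lt_of_le_of_ne dist_nonneg (Ne.symm h0)
  obtain ⟨N, hN⟩ := exists_three_div_lt (half_pos hpos)
  obtain ⟨n, -, hn⟩ := Finset.exists_max_image (Finset.range (N + 1))
    (fun n : ℕ => 1 / ((n : ℝ) + 1) * dist (a.1 n) (b.1 n)) ⟨0, by simp⟩
  refine ⟨n, le_antisymm ?_ (le_ciSup (bddAbove_limit a b) n)⟩
  by_contra hlt
  have : dist a b ≤ max (1 / ((n : ℝ) + 1) * dist (a.1 n) (b.1 n)) (dist a b / 2) := by
    refine dist_le_of_forall fun m => ?_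
    by_cases hm : m < N + 1
    · exact le_max_of_le_left (hn m (Finset.mem_range.2 hm))
    · exact le_max_of_le_right ((one_div_mul_dist_le_three a b m).trans (hN m (by omega)).le)
  rcases le_max_iff.1 this with h | h
  · exact hlt h
  · linarith

/-- Each coordinate of a point of `A` is an end of the edge through the next coordinate of some point
of a dense subset `D`. So every projection of `A` has at most `|D|` points, and there are at most
`|D|` distances at each level. -/
lemma isEconomical (P : PremetricSpace.{u}) : IsEconomical (CobwebLimit P) := by
  intro A hA
  obtain ⟨D, hDA, hAD, hD⟩ : dens A ∈ {κ | ∃ D : Set (CobwebLimit P), D ⊆ A ∧ A ⊆ closure D ∧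
      Cardinal.mk D = κ} := csInf_mem ⟨_, A, Subset.rfl, subset_closure, rfl⟩
  have hDinf : Infinite D := by
    rw [infinite_coe_iff]
    intro hfin
    rw [hfin.isClosed.closure_eq] at hAD
    exact hA (hfin.subset hAD)
  let e : ∀ n, D × Bool → Cobweb (iter P n) := fun n d =>
    if d.2 then bond P n (d.1.1.1 (n + 1)) else farEnd (iter P (n + 1)) (d.1.1.1 (n + 1))
  have he : ∀ n, ∀ a ∈ A, ∃ d, e n d = a.1 n := by
    intro n a ha
    have h1 : a.1 (n + 1) ∈ closure ((fun b : CobwebLimit P => b.1 (n + 1)) '' D) :=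
      image_closure_subset_closure_image (continuous_coord (n + 1)) ⟨a, hAD ha, rfl⟩
    obtain ⟨_, ⟨d, hd, rfl⟩, h | h⟩ := exists_compression_or_farEnd_eq (P := iter P (n + 1)) h1
    · exact ⟨(⟨d, hd⟩, true), h.symm.trans (bond_coe a n)⟩
    · exact ⟨(⟨d, hd⟩, false), h.symm.trans (bond_coe a n)⟩
  let g : ℕ × (D × Bool) × (D × Bool) → ℝ := fun x =>
    1 / ((x.1 : ℝ) + 1) * dist (e x.1 x.2.1) (e x.1 x.2.2)
  have hg : image2 (fun a b : CobwebLimit P => dist a b) A A ⊆ range g := by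
    rintro _ ⟨a, ha, b, hb, rfl⟩
    obtain ⟨n, hn⟩ := exists_dist_eq a b
    obtain ⟨d, hd⟩ := he n a ha
    obtain ⟨d', hd'⟩ := he n b hb
    exact ⟨(n, d, d'), by simp only [g, hd, hd', hn]⟩
  have hinf : Cardinal.aleph0 ≤ Cardinal.mk D := Cardinal.infinite_iff.1 hDinf
  have hcard : Cardinal.mk (ℕ × (D × Bool) × (D × Bool)) = Cardinal.mk D := by
    simp only [Cardinal.mk_prod, Cardinal.lift_id, Cardinal.lift_uzero, Cardinal.mk_nat,
      Cardinal.lift_aleph0, Cardinal.mk_bool, Cardinal.lift_ofNat]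
    rw [Cardinal.mul_eq_left hinf ((Cardinal.ofNat_lt_aleph0).le.trans hinf) (by norm_num),
      Cardinal.mul_eq_self hinf, Cardinal.aleph0_mul_eq hinf]
  rw [← hD, ← hcard]
  exact (Cardinal.lift_le.2 (Cardinal.mk_le_mk_of_subset hg)).trans
    (Cardinal.mk_range_le_lift)

end CobwebLimit

/-- A separable connected subspace of an economical space has only countably many distances, while
the distances from a point of a nontrivial connected metric space fill an interval. -/
lemma IsEconomical.exists_eq_singleton {Y : Type u} [MetricSpace Y] (hY : IsEconomical Y)
    {A : Set Y} (hA : IsConnected A) (hs : TopologicalSpace.SeparableSpace A) :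
    ∃ y, A = {y} := by
  obtain ⟨x, hx⟩ := hA.nonempty
  refine ⟨x, eq_singleton_iff_unique_mem.2 ⟨hx, fun y hy => ?_⟩⟩
  by_contra hne
  have hpos : 0 < dist y x := dist_pos.2 hne
  have hsub : Icc 0 (dist y x) ⊆ (fun z => dist z x) '' A := by
    have hp : IsPreconnected ((fun z => dist z x) '' A) :=
      hA.isPreconnected.image _ (continuous_id.dist continuous_const).continuousOn
    exact hp.Icc_subset ⟨x, hx, dist_self x⟩ ⟨y, hy, rfl⟩
  have hinf : A.Infinite := fun hfin =>
    (Icc_infinite hpos) ((hfin.image _).subset hsub)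
  obtain ⟨s, hs, hd⟩ := TopologicalSpace.exists_countable_dense A
  have hdens : dens A ≤ Cardinal.aleph0 := by
    have hmem : Cardinal.mk (Subtype.val '' s : Set Y) ∈
        {κ | ∃ D : Set Y, D ⊆ A ∧ A ⊆ closure D ∧ Cardinal.mk D = κ} := by
      refine ⟨_, ?_, fun a ha => ?_, rfl⟩
      · rintro _ ⟨a, -, rfl⟩
        exact a.2
      · exact image_closure_subset_closure_image continuous_subtype_val ⟨⟨a, ha⟩, hd _, rfl⟩
    exact (csInf_le' hmem).trans (Cardinal.le_aleph0_iff_set_countable.2 (hs.image _))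
  have h1 := (hY A hinf).trans (Cardinal.lift_le.2 hdens)
  rw [Cardinal.lift_aleph0, Cardinal.lift_le_aleph0, Cardinal.le_aleph0_iff_set_countable] at h1
  have h2 : (Icc 0 (dist y x)).Countable := by
    refine h1.mono (hsub.trans ?_)
    rintro _ ⟨z, hz, rfl⟩
    exact ⟨z, hz, x, hx, rfl⟩
  rw [← Cardinal.le_aleph0_iff_set_countable, Cardinal.mk_Icc_real hpos] at h2
  exact absurd h2 (not_le.2 Cardinal.aleph0_lt_continuum)

end Economy

/-! ### Cardinality -/

section Cardinality

open Cardinal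

lemma mk_oGraph_le {Q : Type u} {μ : Cardinal.{u}} (hμ : continuum ≤ μ) (hQ : #Q ≤ μ) :
    #(OGraph Q) ≤ μ := by
  have hinf : ℵ₀ ≤ μ := aleph0_le_continuum.trans hμ
  let φ : OGraph Q → Q ⊕ (Q × Q × ℝ) := fun a => match a with
    | vertex x => Sum.inl x
    | edge x y _ t _ => Sum.inr (x, y, t)
  have hφ : Function.Injective φ := by
    intro a b hab
    cases a <;> cases b <;> simp_all [φ]
  have h := mk_le_of_injective hφ
  simp only [mk_sum, mk_prod, Cardinal.lift_id, lift_uzero, mk_real, lift_continuum] at h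
  refine h.trans ?_
  calc #Q + #Q * (#Q * continuum) ≤ μ + μ * (μ * μ) := by gcongr
    _ = μ := by rw [mul_eq_self hinf, mul_eq_self hinf, add_eq_self hinf]

lemma mk_cobweb_le {P : PremetricSpace.{u}} {μ : Cardinal.{u}} (hμ : continuum ≤ μ)
    (hP : #P.carrier ≤ μ) : #(Cobweb P) ≤ μ :=
  (mk_subtype_le _).trans (mk_oGraph_le hμ hP)

lemma mk_iter_le {P : PremetricSpace.{u}} {μ : Cardinal.{u}} (hμ : continuum ≤ μ)
    (hP : #P.carrier ≤ μ) : ∀ n, #(iter P n).carrier ≤ μ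
  | 0 => hP
  | n + 1 => mk_cobweb_le hμ (mk_iter_le hμ hP n)

lemma mk_cobwebLimit_le {P : PremetricSpace.{u}} {μ : Cardinal.{u}} (hμ : continuum ≤ μ)
    (hP : #P.carrier ≤ μ) : #(CobwebLimit P) ≤ μ ^ aleph0.{u} := by
  refine (mk_subtype_le _).trans ?_
  have h : #(∀ n, Cobweb (iter P n)) ≤ Cardinal.prod fun _ : ℕ => μ := by
    rw [mk_pi]
    exact prod_le_prod _ _ fun n => mk_cobweb_le hμ (mk_iter_le hμ hP n)
  simpa using h

end Cardinality

/-! ### The convergent sequence and its continuous images -/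

lemma zero_mem_S₀ : (0 : ℝ) ∈ S₀ := Or.inl rfl

lemma one_div_mem_S₀ {n : ℕ} (hn : 1 ≤ n) : 1 / (n : ℝ) ∈ S₀ := Or.inr ⟨n, hn, rfl⟩

lemma isOpen_of_forall_one_div_mem {U : Set S₀}
    (hU : (⟨0, zero_mem_S₀⟩ : S₀) ∈ U → ∃ N : ℕ, ∀ (n : ℕ) (hn : 1 ≤ n), N ≤ n →
      (⟨1 / (n : ℝ), one_div_mem_S₀ hn⟩ : S₀) ∈ U) : IsOpen U := by
  rw [Metric.isOpen_iff]
  rintro ⟨t, ht | ⟨n, hn, rfl⟩⟩ htU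
  · obtain rfl : t = 0 := ht
    obtain ⟨N, hN⟩ := hU htU
    refine ⟨1 / ((N : ℝ) + 1), by positivity, ?_⟩
    rintro ⟨s, hs | ⟨m, hm, rfl⟩⟩ hsU
    · obtain rfl : s = 0 := hs
      exact htU
    · refine hN m hm ?_
      have hm0 : (0 : ℝ) < m := Nat.cast_pos.2 hm
      have h1 : 1 / (m : ℝ) < 1 / ((N : ℝ) + 1) := by
        have : |1 / (m : ℝ) - 0| < 1 / ((N : ℝ) + 1) := hsU
        rwa [sub_zero, abs_of_pos (by positivity)] at this
      rw [one_div_lt_one_div hm0 (by positivity)] at h1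
      exact_mod_cast (show (N : ℝ) ≤ m by linarith)
  · -- Consecutive reciprocals near `1 / n` differ by at least `1 / (n (n + 1))`.
    have hn0 : (0 : ℝ) < n := Nat.cast_pos.2 hn
    refine ⟨1 / ((n : ℝ) * (n + 1)), by positivity, ?_⟩
    rintro ⟨s, hs⟩ hsU
    have hd : |s - 1 / (n : ℝ)| < 1 / ((n : ℝ) * (n + 1)) := hsU
    suffices s = 1 / (n : ℝ) by subst this; exact htU
    have hd1 : 1 / ((n : ℝ) * (n + 1)) ≤ 1 / n := by
      apply one_div_le_one_div_of_le hn0; nlinarith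
    rcases hs with hs | ⟨m, hm, rfl⟩
    · obtain rfl : s = 0 := hs
      rw [zero_sub, abs_neg, abs_of_pos (by positivity)] at hd
      linarith
    · have hm0 : (0 : ℝ) < m := Nat.cast_pos.2 hm
      have heq : 1 / (m : ℝ) - 1 / n = (n - m) / (m * n) := by field_simp
      rw [heq, abs_div, abs_of_pos (mul_pos hm0 hn0), div_lt_div_iff₀ (by positivity)
        (by positivity), one_mul] at hd
      have h2 : |(n : ℝ) - m| * (n + 1) < m := by nlinarith
      by_contra hne
      have hnm : (n : ℤ) - m ≠ 0 := by
        intro h0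
        apply hne
        have : n = m := by omega
        rw [this]
      have h3 : (1 : ℝ) ≤ |(n : ℝ) - m| := by
        have := Int.one_le_abs hnm
        exact_mod_cast this
      have h4 : (m : ℝ) - n ≤ |(n : ℝ) - m| := by rw [abs_sub_comm]; exact le_abs_self _
      nlinarith

lemma tendsto_one_div_S₀ :
    Tendsto (fun n : ℕ => (⟨1 / ((n + 1 : ℕ) : ℝ), one_div_mem_S₀ n.succ_pos⟩ : S₀)) atTop
      (𝓝 ⟨0, zero_mem_S₀⟩) := by
  rw [tendsto_subtype_rng]
  simpa using tendsto_one_div_add_atTop_nhds_zero_nat (𝕜 := ℝ)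

variable {X : Type u} [TopologicalSpace X]

/-- A convergent sequence in `X` and its limit are the values of a continuous map on `S₀`. -/
lemma exists_continuousMap_of_tendsto {x : ℕ → X} {p : X} (h : Tendsto x atTop (𝓝 p)) :
    ∃ f : C(S₀, X), f ⟨0, zero_mem_S₀⟩ = p ∧
      ∀ (n : ℕ) (hn : 1 ≤ n), f ⟨1 / (n : ℝ), one_div_mem_S₀ hn⟩ = x n := by
  classical
  let f : S₀ → X := fun t => if (t : ℝ) = 0 then p else x ⌊1 / (t : ℝ)⌋₊
  have hf0 : f ⟨0, zero_mem_S₀⟩ = p := if_pos rfl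
  have hf : ∀ (n : ℕ) (hn : 1 ≤ n), f ⟨1 / (n : ℝ), one_div_mem_S₀ hn⟩ = x n := fun n hn => by
    have hn0 : (n : ℝ) ≠ 0 := by positivity
    simp [f, show n ≠ 0 by omega]
  refine ⟨⟨f, continuous_def.2 fun V hV => isOpen_of_forall_one_div_mem fun h0 => ?_⟩, hf0, hf⟩
  rw [mem_preimage, hf0] at h0
  obtain ⟨N, hN⟩ := eventually_atTop.1 (h.eventually (hV.mem_nhds h0))
  exact ⟨N, fun n hn hNn => by rw [mem_preimage, hf n hn]; exact hN n hNn⟩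

lemma SeqOpen.isOpen_preimage {V : Set X} (hV : SeqOpen V) (f : C(S₀, X)) : IsOpen (f ⁻¹' V) := by
  refine isOpen_of_forall_one_div_mem fun h0 => ?_
  obtain ⟨N, hN⟩ := hV _ _ ((f.continuous.tendsto _).comp tendsto_one_div_S₀) h0
  refine ⟨N + 1, fun n hn hNn => ?_⟩
  obtain ⟨k, rfl⟩ : ∃ k, n = k + 1 := ⟨n - 1, by omega⟩
  exact hN k (by omega)

lemma seqOpen_of_isOpen {V : Set X} (hV : IsOpen V) : SeqOpen V := fun _ _ hx hp =>
  eventually_atTop.1 (hx.eventually (hV.mem_nhds hp))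

lemma SeqOpen.isOpen [SequentialSpace X] {V : Set X} (hV : SeqOpen V) : IsOpen V := by
  rw [← isClosed_compl_iff]
  refine IsSeqClosed.isClosed fun x p hx hp hpV => ?_
  obtain ⟨n, hn⟩ := hV x p hp hpV
  exact hx n (hn n le_rfl)

/-! ### The resolution map -/

instance (X : Type u) [TopologicalSpace X] : CompleteSpace (EconomicalResolution X) :=
  inferInstanceAs (CompleteSpace (CobwebLimit (seqDecomposition X)))

/-- The value of a resolution thread only depends on the base point `(f, t)` of the thread. -/
lemma resolution_eq {a : EconomicalResolution X} {f : C(S₀, X)} {t : S₀}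
    (h : limitCompression (seqDecomposition X) a = (f, t)) : resolution X a = f t := by
  change calculation X (limitCompression (seqDecomposition X) a) = f t
  rw [h]
  rfl

/-- Close to a thread over `(f, t)`, the resolution map takes only values `f s` with `s` close to
`t`. -/
lemma exists_eventually_resolution_eq (a : EconomicalResolution X) :
    ∃ (f : C(S₀, X)) (t : S₀), resolution X a = f t ∧
      ∀ ε > 0, ∀ᶠ b in 𝓝 a, ∃ s : S₀, dist s t < ε ∧ resolution X b = f s := by
  classical
  obtain ⟨⟨f, t⟩, hft⟩ : ∃ p : C(S₀, X) × S₀, limitCompression (seqDecomposition X) a = p :=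
    ⟨_, rfl⟩
  refine ⟨f, t, resolution_eq hft, fun ε hε => ?_⟩
  have hev : ∀ δ > 0, ∀ᶠ b : EconomicalResolution X in 𝓝 a, dist (b.1 0) (a.1 0) < δ := fun δ hδ =>
    (CobwebLimit.continuous_coord (P := seqDecomposition X) 0).continuousAt.eventually
      (Metric.ball_mem_nhds _ hδ)
  by_cases hv : ∃ v, a.1 0 = Cobweb.vertex (P := seqDecomposition X) v
  · obtain ⟨v, hv⟩ := hv
    obtain rfl : v = (f, t) := by
      rw [← hft]
      exact (compression_eq_of_val_vertex (P := seqDecomposition X)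
        (congrArg Subtype.val hv)).symm
    filter_upwards [hev (min ε 1) (by positivity)] with b hb
    rw [lt_min_iff, hv] at hb
    obtain ⟨⟨g, s⟩, hgs⟩ : ∃ p : C(S₀, X) × S₀, limitCompression (seqDecomposition X) b = p :=
      ⟨_, rfl⟩
    have hgs' : compression (seqDecomposition X) (b.1 0) = (g, s) := hgs
    rw [resolution_eq hgs]
    rcases compression_of_dist_vertex_lt_one (P := seqDecomposition X) hb.2 with h | ⟨-, h⟩
    · obtain ⟨rfl, rfl⟩ := Prod.mk.inj (hgs'.symm.trans h)
      exact ⟨s, by rwa [dist_self], rfl⟩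
    · rw [hgs'] at h
      change (if f t = g s then (0 : ℝ) else if f = g then |(t : ℝ) - s| else 1) ≤ _ at h
      split_ifs at h with h1 h2
      · exact ⟨t, by rwa [dist_self], h1.symm⟩
      · refine ⟨s, ?_, by rw [h2]⟩
        rw [dist_comm]
        exact lt_of_le_of_lt h hb.1
      · exact absurd hb.2 (not_lt.2 h)
  · obtain ⟨δ, hδ, h⟩ := exists_forall_compression_eq (P := seqDecomposition X)
      fun v hv' => hv ⟨v, hv'⟩
    filter_upwards [hev δ hδ] with b hb
    exact ⟨t, by rwa [dist_self], resolution_eq ((h _ hb).trans hft)⟩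

/-- Convergent sequences in `X` lift to `EX`: the points `(f, 1 / n)` of `DX` are at distance at
most `1 / n` from `(f, 0)`. -/
lemma exists_tendsto_resolution_eq {x : ℕ → X} {p : X} (h : Tendsto x atTop (𝓝 p)) :
    ∃ (b : ℕ → EconomicalResolution X) (a : EconomicalResolution X), Tendsto b atTop (𝓝 a) ∧
      resolution X a = p ∧ ∀ n, resolution X (b n) = x n := by
  classical
  -- The shift by two makes all the radii `2 / (n + 2)` at most one.
  obtain ⟨f, hf0, hf⟩ := exists_continuousMap_of_tendsto (x := fun n => x (n - 2)) (p := p)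
    (h.comp (tendsto_sub_atTop_nat 2))
  obtain ⟨a, ha, hav⟩ := CobwebLimit.exists_isVertical (P := seqDecomposition X) (n := 0)
    (Cobweb.vertex (P := seqDecomposition X) (f, ⟨0, zero_mem_S₀⟩))
  have hb : ∀ n : ℕ, ∃ b : EconomicalResolution X, resolution X b = x n ∧
      dist b a ≤ 2 / ((n : ℝ) + 2) := by
    intro n
    have hn : 1 ≤ n + 2 := by omega
    have hd : (seqDecomposition X).d (f, ⟨0, zero_mem_S₀⟩)
        (f, ⟨1 / ((n + 2 : ℕ) : ℝ), one_div_mem_S₀ hn⟩) ≤ 1 / ((n : ℝ) + 2) := by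
      have hpos : (0 : ℝ) < 1 / ((n : ℝ) + 2) := by positivity
      change (if f _ = f _ then (0 : ℝ) else if f = f then |(0 : ℝ) - 1 / ((n + 2 : ℕ) : ℝ)|
        else 1) ≤ _
      split_ifs
      · exact hpos.le
      · push_cast
        rw [zero_sub, abs_neg, abs_of_pos hpos]
      · contradiction
    obtain ⟨b, hb, hba⟩ := CobwebLimit.exists_limitCompression_eq_dist_le ha hav
      (r := 2 / ((n : ℝ) + 2)) (by rw [div_le_one (by positivity)]; linarith [n.cast_nonneg (α := ℝ)])
      (hd.trans_lt (div_lt_div_of_pos_right one_lt_two (by positivity)))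
    exact ⟨b, (resolution_eq hb).trans (hf _ hn), hba⟩
  choose b hbx hba using hb
  refine ⟨b, a, tendsto_iff_dist_tendsto_zero.2 ?_, ?_, hbx⟩
  · refine squeeze_zero (fun _ => dist_nonneg) hba ?_
    exact tendsto_const_nhds.div_atTop
      (tendsto_atTop_add_const_right _ _ tendsto_natCast_atTop_atTop)
  · refine (resolution_eq (f := f) (t := ⟨0, zero_mem_S₀⟩) ?_).trans hf0
    unfold limitCompression
    rw [ha]
    rfl

lemma resolution_surjective (X : Type u) [TopologicalSpace X] :
    Function.Surjective (resolution X) := fun p => by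
  obtain ⟨-, a, -, ha, -⟩ := exists_tendsto_resolution_eq (tendsto_const_nhds (x := p))
  exact ⟨a, ha⟩

lemma isOpen_resolution_preimage_iff {V : Set X} :
    IsOpen (resolution X ⁻¹' V) ↔ SeqOpen V := by
  constructor
  · intro hV x p hx hp
    obtain ⟨b, a, hba, rfl, hb⟩ := exists_tendsto_resolution_eq hx
    obtain ⟨n, hn⟩ := eventually_atTop.1 (hba.eventually (hV.mem_nhds hp))
    exact ⟨n, fun m hm => by rw [← hb]; exact hn m hm⟩
  · refine fun hV => isOpen_iff_mem_nhds.2 fun a ha => ?_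
    obtain ⟨f, t, hft, h⟩ := exists_eventually_resolution_eq a
    obtain ⟨ε, hε, hεV⟩ := Metric.isOpen_iff.1 (hV.isOpen_preimage f) t
      (show f t ∈ V from hft ▸ ha)
    filter_upwards [h ε hε] with b ⟨s, hs, hb⟩
    rw [mem_preimage, hb]
    exact hεV hs

lemma continuous_resolution : Continuous (resolution X) :=
  continuous_def.2 fun _ hV => isOpen_resolution_preimage_iff.2 (seqOpen_of_isOpen hV)

lemma isQuotientMap_resolutionSeq : IsQuotientMap (resolutionSeq X) :=
  ⟨isCoinducing_iff.2 fun V => isOpen_resolution_preimage_iff (X := X) (V := V),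
    resolution_surjective X⟩

/-- The points of `DX` with the same value are at distance zero from each other, hence the fibres
of `ξ` in the first cobweb are connected. -/
lemma isMonotoneSurjection_resolutionSeq : IsMonotoneSurjection (resolutionSeq X) := by
  classical
  refine ⟨isQuotientMap_resolutionSeq.surjective, fun z =>
    ⟨isQuotientMap_resolutionSeq.surjective z, ?_⟩⟩
  refine CobwebLimit.isPreconnected_coord_preimage (P := seqDecomposition X) (n := 0)
    (isPreconnected_compression_preimage (F := calculation X ⁻¹' {z}) ?_)
  rintro ⟨f, t⟩ hp ⟨g, s⟩ hq
  have h : f t = g s := (show f t = z from hp).trans (show g s = z from hq).symm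
  change (if f t = g s then (0 : ℝ) else _) = 0
  rw [if_pos h]

lemma IsMonotoneSurjection.connectedSpace {Y Z : Type u} [TopologicalSpace Y] [TopologicalSpace Z]
    {f : Y → Z} (hf : IsMonotoneSurjection f) (hq : IsQuotientMap f) [ConnectedSpace Z] :
    ConnectedSpace Y := by
  have hne : Nonempty Y := (hf.1 (Classical.arbitrary Z)).nonempty
  have hpre : PreconnectedSpace Y := by
    refine preconnectedSpace_iff_clopen.2 fun s hs => ?_
    have hfib : ∀ y ∈ s, ∀ y', f y' = f y → y' ∈ s := fun y hy y' h =>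
      (hf.2 (f y)).isPreconnected.subset_isClopen hs ⟨y, rfl, hy⟩ h
    have hpre : f ⁻¹' (f '' s) = s := by
      refine Subset.antisymm ?_ (subset_preimage_image f s)
      rintro y' ⟨y, hy, h⟩
      exact hfib y hy y' h.symm
    have hcl : IsClopen (f '' s) := by
      rw [← hpre] at hs
      exact ⟨hq.isClosed_preimage.1 hs.1, hq.isOpen_preimage.1 hs.2⟩
    rcases isClopen_iff.1 hcl with h | h
    · exact Or.inl (image_eq_empty.1 h)
    · right
      rw [← hpre, h, preimage_univ]
  exact { hpre with toNonempty := hne }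

lemma isQuotientMap_resolution_iff : IsQuotientMap (resolution X) ↔ SequentialSpace X := by
  refine ⟨fun h => h.sequentialSpace, fun _ =>
    ⟨isCoinducing_iff.2 fun V => ?_, resolution_surjective X⟩⟩
  rw [isOpen_resolution_preimage_iff]
  exact ⟨SeqOpen.isOpen, seqOpen_of_isOpen⟩

lemma IsHereditarilyQuotient.frechetUrysohnSpace {Y Z : Type u} [TopologicalSpace Y]
    [FrechetUrysohnSpace Y] [TopologicalSpace Z] {f : Y → Z} (hf : IsHereditarilyQuotient f)
    (hc : Continuous f) : FrechetUrysohnSpace Z := by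
  refine ⟨fun A z hz => ?_⟩
  by_cases hzA : z ∈ A
  · exact ⟨fun _ => z, fun _ => hzA, tendsto_const_nhds⟩
  -- As `z` is not isolated in `insert z A`, its fibre is not open in the preimage of this set.
  have hq := hf (insert z A)
  let z' : (insert z A : Set Z) := ⟨z, mem_insert z A⟩
  have hno : ¬ IsOpen ((insert z A).restrictPreimage f ⁻¹' {z'}) := by
    intro h
    obtain ⟨U, hU, hUz⟩ := isOpen_induced_iff.1 (hq.isOpen_preimage.1 h)
    have hzU : z ∈ U := by
      have : z' ∈ Subtype.val ⁻¹' U := hUz ▸ rfl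
      exact this
    obtain ⟨w, hwU, hwA⟩ := mem_closure_iff.1 hz U hU hzU
    have hw : (⟨w, mem_insert_of_mem z hwA⟩ : (insert z A : Set Z)) ∈ ({z'} : Set _) :=
      hUz ▸ (show w ∈ U from hwU)
    obtain rfl : w = z := congrArg Subtype.val (show _ = z' from hw)
    exact hzA hwA
  have hex : ∃ y, f y = z ∧ y ∈ closure (f ⁻¹' A) := by
    by_contra hex
    push Not at hex
    refine hno (isOpen_induced_iff.2 ⟨(closure (f ⁻¹' A))ᶜ, isClosed_closure.isOpen_compl, ?_⟩)
    ext ⟨y, hy⟩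
    constructor
    · intro h
      refine Subtype.ext ((mem_insert_iff.1 hy).resolve_right fun hyA => h (subset_closure hyA))
    · intro h
      exact hex y (Subtype.ext_iff.1 (show _ = z' from h))
  obtain ⟨y, rfl, hy⟩ := hex
  obtain ⟨x, hx, hxy⟩ := mem_closure_iff_seq_limit.1 hy
  exact ⟨fun n => f (x n), hx, (hc.tendsto y).comp hxy⟩

lemma isHereditarilyQuotient_resolution_iff :
    IsHereditarilyQuotient (resolution X) ↔ FrechetUrysohnSpace X := by
  refine ⟨fun h => h.frechetUrysohnSpace continuous_resolution, fun _ A => ?_⟩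
  refine ⟨isCoinducing_iff.2 fun V =>
    ⟨fun hV => ?_, fun hV => hV.preimage continuous_resolution.restrictPreimage⟩,
    (resolution_surjective X).restrictPreimage A⟩
  rw [← isClosed_compl_iff]
  refine IsSeqClosed.isClosed fun x p hx hp hpV => ?_
  obtain ⟨b, a, hba, ha, hb⟩ := exists_tendsto_resolution_eq
    ((continuous_subtype_val.tendsto p).comp hp)
  have haA : a ∈ resolution X ⁻¹' A := by rw [mem_preimage, ha]; exact p.2
  have hbA : ∀ n, b n ∈ resolution X ⁻¹' A := fun n => by
    rw [mem_preimage, hb]; exact (x n).2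
  have hlim : Tendsto (fun n => (⟨b n, hbA n⟩ : resolution X ⁻¹' A)) atTop (𝓝 ⟨a, haA⟩) :=
    tendsto_subtype_rng.2 hba
  have hmem : (⟨a, haA⟩ : resolution X ⁻¹' A) ∈ A.restrictPreimage (resolution X) ⁻¹' V := by
    rw [mem_preimage, show A.restrictPreimage (resolution X) ⟨a, haA⟩ = p from Subtype.ext ha]
    exact hpV
  obtain ⟨n, hn⟩ := eventually_atTop.1 (hlim.eventually (hV.mem_nhds hmem))
  have hn' := hn n le_rfl
  rw [show A.restrictPreimage (resolution X) ⟨b n, hbA n⟩ = x n from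
    Subtype.ext (hb n)] at hn'
  exact hx n hn'

open Cardinal in
lemma mk_economicalResolution_le (X : Type u) [TopologicalSpace X] :
    #(EconomicalResolution X) ≤ continuum.{u} * #X ^ aleph0.{u} := by
  rcases isEmpty_or_nonempty X with hX | hX
  · have : IsEmpty (EconomicalResolution X) := ⟨fun a => hX.false (resolution X a)⟩
    simp
  have hpow : 1 ≤ #X ^ aleph0.{u} := Cardinal.one_le_iff_ne_zero.2
    (power_ne_zero _ (mk_ne_zero X))
  have hμ : continuum.{u} ≤ continuum.{u} * #X ^ aleph0.{u} := le_mul_of_one_le_right' hpow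
  have hS : #S₀ ≤ aleph0 := by
    rw [le_aleph0_iff_set_countable]
    refine (countable_singleton _).union ((countable_range fun n : ℕ => 1 / (n : ℝ)).mono ?_)
    rintro _ ⟨n, -, rfl⟩
    exact ⟨n, rfl⟩
  have hS' : lift.{u} #S₀ ≤ aleph0.{u} := by
    rw [lift_le_aleph0]; exact hS
  have hC : #C(S₀, X) ≤ #X ^ aleph0.{u} := by
    refine (mk_le_of_injective (DFunLike.coe_injective (F := C(S₀, X)))).trans ?_
    rw [mk_arrow, lift_uzero]
    exact power_le_power_left (mk_ne_zero X) hS'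
  have hP : #(seqDecomposition X).carrier ≤ continuum.{u} * #X ^ aleph0.{u} := by
    change #(C(S₀, X) × S₀) ≤ _
    rw [mk_prod, lift_uzero, mul_comm]
    exact mul_le_mul' (hS'.trans aleph0_le_continuum) hC
  refine (mk_cobwebLimit_le hμ hP).trans (le_of_eq ?_)
  rw [mul_power, continuum_power_aleph0, ← power_mul, aleph0_mul_aleph0]

end EconRes

open EconRes Topology
theorem theorem9p1 (X : Type u) [TopologicalSpace X] :
    (IsEconomical (EconomicalResolution X) ∧
      CompleteSpace (EconomicalResolution X) ∧
      Cardinal.mk (EconomicalResolution X) ≤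
        Cardinal.continuum.{u} * Cardinal.mk X ^ Cardinal.aleph0.{u}) ∧
    (IsMonotoneSurjection (resolutionSeq X) ∧ IsQuotientMap (resolutionSeq X)) ∧
    (ConnectedSpace (EconomicalResolution X) ↔ ConnectedSpace (SeqCoreflexion X)) ∧
    (IsQuotientMap (resolution X) ↔ SequentialSpace X) ∧
    (IsHereditarilyQuotient (resolution X) ↔ FrechetUrysohnSpace X) ∧
    (∀ a : EconomicalResolution X, ∃ U ∈ 𝓝 a, ∃ f : C(S₀, X),
      resolution X '' U ⊆ Set.range f) ∧
    (ConnectedSpace X → SequentialSpace X →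
      IsNonseparablyConnected (EconomicalResolution X) ∧
      IsMonotoneSurjection (resolution X) ∧ IsQuotientMap (resolution X)) := by
  have hconn : ConnectedSpace (EconomicalResolution X) ↔ ConnectedSpace (SeqCoreflexion X) :=
    ⟨fun _ => isQuotientMap_resolutionSeq.surjective.connectedSpace
      isQuotientMap_resolutionSeq.continuous,
    fun _ => isMonotoneSurjection_resolutionSeq.connectedSpace isQuotientMap_resolutionSeq⟩
  have hecon : IsEconomical (EconomicalResolution X) := CobwebLimit.isEconomical _
  refine ⟨⟨hecon, inferInstance, mk_economicalResolution_le X⟩,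
    ⟨isMonotoneSurjection_resolutionSeq, isQuotientMap_resolutionSeq⟩, hconn,
    isQuotientMap_resolution_iff, isHereditarilyQuotient_resolution_iff, fun a => ?_,
    fun _ hseq => ?_⟩
  · obtain ⟨f, t, -, h⟩ := exists_eventually_resolution_eq a
    refine ⟨_, h 1 one_pos, f, ?_⟩
    rintro _ ⟨b, ⟨s, -, hb⟩, rfl⟩
    exact ⟨s, hb.symm⟩
  · -- The topologies of `X` and `sX` coincide, so monotonicity passes from `sX` to `X`.
    have hq : IsQuotientMap (resolution X) := isQuotientMap_resolution_iff.2 hseq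
    have hm : IsMonotoneSurjection (resolution X) := isMonotoneSurjection_resolutionSeq (X := X)
    exact ⟨⟨hm.connectedSpace hq, fun A hA hs => hecon.exists_eq_singleton hA hs⟩, hm, hq⟩
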